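/- Let $C$ be a smooth projective geometrically irreducible curve over a field $K$. A chain $\mathcal E_\bullet=(\mathcal E_r\to\mathcal E_{r-1}\to\dots\to\mathcal E_0)$ on $C$ consists of vector bundles $\mathcal E_i$ of rank $n_i\ge 0$ and degree $d_i\in\mathbb Z$ and $\mathcal O_C$-linear maps $\phi_i\colon\mathcal E_i\to\mathcal E_{i-1}$. For $\alpha=(\alpha_0,\dots,\alpha_r)\in\mathbb R^{r+1}$ its $\alpha$-slope is $$\mu_\alpha(\mathcal E_\bullet)=\mu_\alpha(\underline n,\underline d):=\frac{\sum_{i=0}^r(d_i+\alpha_i n_i)}{\sum_{i=0}^r n_i},$$ and $\mathcal E_\bullet$ is $\alpha$-semistable if $\mu_\alpha(\mathcal F_\bullet)\le\mu_\alpha(\mathcal E_\bullet)$ for every nonzero subchain $\mathcal F_\bullet\subset\mathcal E_\bullet$ (subsheaves $\mathcal F_i\subset\mathcal E_i$, again vector bundles, with $\phi_i(\mathcal F_i)\subset\mathcal F_{i-1}$). Fix $\underline n=(n_0,\dots,n_r)$, $\underline d=(d_0,\dots,d_r)$ and $\alpha$ with $\alpha_0<\alpha_1<\dots<\alpha_r$,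 and put $\mu_\bullet:=\mu_\alpha(\underline n,\underline d)$. If an $\alpha$-semistable chain of rank $\underline n$ and degree $\underline d$ exists, then the following hold, where an inequality containing a fraction (or slope) with denominator $0$ is omitted (this happens for none of the inequalities if all $n_i>0$): 1. For all $j\in\{0,\dots,r-1\}$: $\displaystyle \frac{\sum_{i=0}^j(d_i+\alpha_i n_i)}{\sum_{i=0}^j n_i}\le\mu_\bullet$. 2. For all $1\le j\le r$ with $n_j=n_{j-1}$: $\displaystyle \frac{d_j}{n_j}\le\frac{d_{j-1}}{n_{j-1}}$. 3. For all $0\le k<j\le r$ with $n_j<\min\{n_k,\dots,n_{j-1}\}$: $$\frac{\sum_{i\notin[k,j]}(d_i+\alpha_i n_i)+(j-k+1)d_j+\big(\sum_{i=k}^j\alpha_i\big)n_j}{\sum_{i\notin[k,j]}n_i+(j-k+1)n_j}\le\mu_\bullet ,$$ that is, $\mu_\alpha(\underline n',\underline d')\le\mu_\bullet$, where $(\underline n',\underline d')$ arises from $(\underline n,\underline d)$ by replacing $(n_i,d_i)$ by $(n_j,d_j)$ for all $k\le i\le j$. 4. For all $0\le k<j\le r$ such that $n_j>\max\{n_k,\dots,n_{j-1}\}$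 or $n_k<\min\{n_{k+1},\dots,n_j\}$: $$\mu_\bullet\le\mu_\alpha(\underline n'',\underline d''),$$ where $(\underline n'',\underline d'')$ arises from $(\underline n,\underline d)$ by replacing $(n_i,d_i)$ by $(n_k,d_k)$ for all $k\le i\le j$; and moreover, if $\sum_{i=k+1}^j(n_i-n_k)>0$ (which is automatic when $n_k<\min\{n_{k+1},\dots,n_j\}$), $$\frac{\sum_{i=k+1}^j\big(d_i-d_k+\alpha_i(n_i-n_k)\big)}{\sum_{i=k+1}^j(n_i-n_k)}\le\mu_\bullet .$$ -/

import Mathlib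

universe u

open CategoryTheory AlgebraicGeometry TopologicalSpace

/-- A smooth proper (equivalently, in dimension one, smooth projective) geometrically
irreducible curve over a field `k`. -/
structure SmoothProjectiveCurve (k : Type u) [Field k] where
  X : Scheme.{u}
  hom : X ⟶ Spec (CommRingCat.of k)
  smooth : SmoothOfRelativeDimension 1 hom
  proper : IsProper hom
  geomIrreducible : GeometricallyIrreducible hom

namespace SmoothProjectiveCurve

theorem isReduced_of_etale {P A : Type u} [CommRing P] [IsDomain P] [CommRing A] [Algebra P A]
    [Algebra.Etale P A] : IsReduced A := by
  have : Module.Flat P A := inferInstance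
  let K := FractionRing P
  have h1 : Algebra.Etale K (TensorProduct P K A) := inferInstance
  have h2 : IsReduced (TensorProduct P K A) :=
    Algebra.FormallyUnramified.isReduced_of_field K (TensorProduct P K A)
  have hinj : Function.Injective
      (Algebra.TensorProduct.includeRight : A →ₐ[P] TensorProduct P K A) :=
    Algebra.TensorProduct.includeRight_injective (IsFractionRing.injective P K)
  exact isReduced_of_injective _ hinj

variable {k : Type u} [Field k] (C : SmoothProjectiveCurve k)

instance : IrreducibleSpace C.X :=
  haveI := C.geomIrreducible
  GeometricallyIrreducible.irreducibleSpace_of_subsingleton C.hom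

instance : IsLocallyNoetherian C.X :=
  haveI := C.proper
  LocallyOfFiniteType.isLocallyNoetherian C.hom

instance : AlgebraicGeometry.IsReduced C.X := by
  have : ∀ x : C.X, _root_.IsReduced (C.X.presheaf.stalk x) := by
    intro x
    obtain ⟨U, -, V, hV, hx, e, hf⟩ :=
      C.smooth.exists_isStandardSmoothOfRelativeDimension x
    obtain ⟨g, -, hg⟩ := hf.exists_etale_mvPolynomial
    have : Nonempty U := ⟨⟨C.hom x, e hx⟩⟩
    have hred : _root_.IsReduced Γ(C.X, V) := by
      algebraize [g]
      exact isReduced_of_etale (P := MvPolynomial (Fin 1) Γ(Spec (CommRingCat.of k), U))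
    let := TopCat.Presheaf.algebra_section_stalk C.X.presheaf ⟨x, hx⟩
    have := hV.isLocalization_stalk ⟨x, hx⟩
    exact isReduced_localizationPreserves (hV.primeIdealOf ⟨x, hx⟩).asIdeal.primeCompl
      (C.X.presheaf.stalk x) hred
  exact isReduced_of_isReduced_stalk _

instance : IsIntegral C.X := isIntegral_of_irreducibleSpace_of_isReduced _

end SmoothProjectiveCurve

namespace AlgebraicGeometry.Scheme.Modules

/-- Restriction of a section of an `𝒪_X`-module to a smaller open set. -/
noncomputable def res {X : Scheme.{u}} (M : X.Modules) {U W : X.Opens} (h : W ≤ U)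
    (s : Γ(M, U)) : Γ(M, W) :=
  M.presheaf.map (homOfLE h).op s

/-- Sections `s₁, …, sₙ` over `U` form a frame if they define an isomorphism `𝒪_U ^ n ≅ M|_U`,
that is, if they restrict to a basis of the sections over every open subset of `U`. -/
def IsFrame {X : Scheme.{u}} (M : X.Modules) {U : X.Opens} {n : ℕ} (s : Fin n → Γ(M, U)) : Prop :=
  ∀ (W : X.Opens) (h : W ≤ U),
    LinearIndependent Γ(X, W) (fun i => M.res h (s i)) ∧
      Submodule.span Γ(X, W) (Set.range fun i => M.res h (s i)) = ⊤

/-- `M` is a vector bundle of (constant) rank `n`: it is locally isomorphic to `𝒪_X ^ n`. -/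
def IsVectorBundle {X : Scheme.{u}} (M : X.Modules) (n : ℕ) : Prop :=
  ∀ x : X, ∃ (U : X.Opens) (_ : x ∈ U) (s : Fin n → Γ(M, U)), M.IsFrame s

end AlgebraicGeometry.Scheme.Modules

namespace SmoothProjectiveCurve

variable {k : Type u} [Field k] (C : SmoothProjectiveCurve k)

/-- The rational section `s₁ ∧ … ∧ sₙ` of the line bundle `det M` has order `m` at the point `x`:
if `t` is a frame of `M` around `x` and `s = g t` on a nonempty open set, then `m` is the order
of vanishing at `x` of the rational function `det g`. -/
def HasOrderAt (M : C.X.Modules) {U : C.X.Opens} {n : ℕ} (s : Fin n → Γ(M, U))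
    (x : C.X) (m : ℤ) : Prop :=
  ∃ (V : C.X.Opens) (_ : x ∈ V) (t : Fin n → Γ(M, V)) (W : C.X.Opens) (hWU : W ≤ U)
    (hWV : W ≤ V) (hW : genericPoint C.X ∈ W) (g : Matrix (Fin n) (Fin n) Γ(C.X, W)),
    M.IsFrame t ∧
    (∀ i, M.res hWU (s i) = ∑ j, g i j • M.res hWV (t j)) ∧
    m = Scheme.ord (C.X.presheaf.germ W (genericPoint C.X) hW g.det) x

/-- The vector bundle `M` of rank `n` has degree `d`: for some rational frame `s₁, …, sₙ` of `M`,
the divisor `D` of the rational section `s₁ ∧ … ∧ sₙ` of `det M` satisfies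
`∑ D(x) [κ(x) : k] = d`. (The order is zero at the generic point and at all but finitely many
closed points. The degree does not depend on the frame, because principal divisors on a proper
curve have degree zero.) -/
def HasDegree (M : C.X.Modules) (n : ℕ) (d : ℤ) : Prop :=
  ∃ (U : C.X.Opens) (_ : genericPoint C.X ∈ U) (s : Fin n → Γ(M, U)) (D : C.X → ℤ),
    M.IsFrame s ∧ (∀ x, C.HasOrderAt M s x (D x)) ∧
    d = ∑ᶠ x : C.X, D x * (C.hom.residueDegree x : ℤ)

/-- A chain `E_r → E_{r-1} → ⋯ → E_0` of vector bundles on the curve. -/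
structure Chain (r : ℕ) where
  obj : Fin (r + 1) → C.X.Modules
  rank : Fin (r + 1) → ℕ
  isVectorBundle : ∀ i, (obj i).IsVectorBundle (rank i)
  map : ∀ i : Fin r, obj i.succ ⟶ obj i.castSucc

end SmoothProjectiveCurve

/-- The slope `(∑ (d_i + α_i n_i)) / ∑ n_i` attached to ranks `n` and degrees `d`. -/
noncomputable def chainSlope {r : ℕ} (α : Fin (r + 1) → ℝ) (n : Fin (r + 1) → ℕ)
    (d : Fin (r + 1) → ℤ) : ℝ :=
  (∑ i, ((d i : ℝ) + α i * (n i : ℝ))) / ∑ i, (n i : ℝ)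

namespace SmoothProjectiveCurve.Chain

variable {k : Type u} [Field k] {C : SmoothProjectiveCurve k} {r : ℕ}

/-- The bundles of the chain have degrees `d_0, …, d_r`. -/
def HasDegree (E : C.Chain r) (d : Fin (r + 1) → ℤ) : Prop :=
  ∀ i, C.HasDegree (E.obj i) (E.rank i) (d i)

/-- `F` is (isomorphic to) a subchain of `E`: there are injective maps of `𝒪`-modules
`F_i → E_i` compatible with the maps of the chains. -/
def IsSubchain (F E : C.Chain r) : Prop :=
  ∃ ι : ∀ i, F.obj i ⟶ E.obj i, (∀ i, Mono (ι i)) ∧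
    ∀ i : Fin r, F.map i ≫ ι i.castSucc = ι i.succ ≫ E.map i

/-- `α`-semistability: every nonzero subchain `F` of `E` satisfies `μ_α(F) ≤ μ_α(E)`. -/
def IsSemistable (α : Fin (r + 1) → ℝ) (E : C.Chain r) : Prop :=
  ∀ (F : C.Chain r) (d e : Fin (r + 1) → ℤ), E.HasDegree d → F.HasDegree e →
    F.IsSubchain E → F.rank ≠ 0 → chainSlope α F.rank e ≤ chainSlope α E.rank d

end SmoothProjectiveCurve.Chain

/-! All inequalities come from testing semistability on a few canonical subchains. Let μ be the
slope of the chain E and give a subsheaf F ⊂ E_i the excess deg F + (α_i − μ) rk F. Semistability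
says that the total excess of a subchain is at most 0, while that of E is 0.

The truncation to E_0, …, E_j gives (1). For (2) and (3), replace E_i for k ≤ i ≤ j by the saturated
image I_i of E_j. The kernel of I_{i+1} → I_i is a subchain concentrated in one place, so its excess
is at most 0, and the quotient of I_{i+1} by it embeds in I_i, so its degree is at most deg I_i.
Descending induction yields deg I_i − d_j + (α_i − μ)(rk I_i − n_j) ≥ 0; passing from α_{i+1} to α_i
costs nothing since rk I_i ≤ n_j and α is increasing. Adding this to the inequality for the subchain
eliminates the unknown I_i and leaves `GradedChain.IsSemistable.sum_Icc_nonneg`. For (4) the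
argument is dual: the subchain consists of the kernels of E_i → E_k, and the induction uses
subchains that differ from E in one place and contain the image there
(`GradedChain.IsSemistable.sum_Icc_nonpos`).

To make this linear algebra, pass to the generic point. A saturated subsheaf of E_i is a subspace T
of the generic fibre over the function field, and its degree is a sum over points x of the order of
the determinant of a basis of T relative to the lattice T ∩ E_{i,x}. Two facts about degrees
suffice: the zero subspace has degree 0, and if a map of the chain induces A/A' ≅ B/B', then deg A −
deg A' ≤ deg B − deg B' (`OrderSystem.IsLatticeFamily.deg_sub_add_deg_sub_le`). The second follows
from additivity in exact sequences and monotonicity in the lattice.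

The degree is independent of the basis only if principal divisors have degree 0. This is extracted
from semistability itself: `HasDegree` accepts the value computed from any rational frame, so if two
frames gave different values, E as a subchain of itself would violate semistability. -/

/-! ### Bases adapted to exact sequences of vector spaces. -/

open Module in
/-- Adapted bases: a basis of a subspace and lifts of a basis of the quotient form a basis. -/
theorem Module.Basis.exists_sum_of_exact {K V V' V'' ι κ : Type*} [Field K] [AddCommGroup V]
    [Module K V] [AddCommGroup V'] [Module K V'] [AddCommGroup V''] [Module K V'']
    {j : V' →ₗ[K] V} {p : V →ₗ[K] V''} (hj : Function.Injective j)
    (hjp : LinearMap.range j = LinearMap.ker p) (b : Basis ι K V') (c : Basis κ K V'')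
    (u : κ → V) (hu : ∀ i, p (u i) = c i) :
    ∃ e : Basis (ι ⊕ κ) K V, (∀ i, e (Sum.inl i) = j (b i)) ∧ ∀ i, e (Sum.inr i) = u i := by
  have hpj : ∀ v, p (j v) = 0 := fun v => by
    rw [← LinearMap.mem_ker, ← hjp]; exact ⟨v, rfl⟩
  have hli : LinearIndependent K (Sum.elim (fun i => j (b i)) u) := by
    refine LinearIndependent.sum_type ?_ ?_ ?_
    · exact b.linearIndependent.map' j (LinearMap.ker_eq_bot.2 hj)
    · refine LinearIndependent.of_comp p ?_
      have : ⇑p ∘ u = c := funext hu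
      exact this ▸ c.linearIndependent
    · rw [Submodule.disjoint_def]
      intro v hv hv'
      have h0 : p v = 0 := by
        have : Submodule.span K (Set.range fun i => j (b i)) ≤ LinearMap.ker p := by
          rw [Submodule.span_le]; rintro _ ⟨i, rfl⟩; exact hpj _
        exact this hv
      rw [Finsupp.mem_span_range_iff_exists_finsupp] at hv'
      obtain ⟨g, rfl⟩ := hv'
      have : g = 0 := by
        rw [map_finsuppSum] at h0
        simp only [map_smul, hu] at h0
        exact linearIndependent_iff.1 c.linearIndependent g h0
      simp [this]
  have hsp : ⊤ ≤ Submodule.span K (Set.range (Sum.elim (fun i => j (b i)) u)) := by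
    rintro v -
    rw [Set.Sum.elim_range, Submodule.span_union]
    have h1 : p v ∈ Submodule.span K (Set.range c) := by rw [c.span_eq]; trivial
    have h2 : Submodule.span K (Set.range c) = (Submodule.span K (Set.range u)).map p := by
      rw [Submodule.map_span, ← Set.range_comp]
      congr 2
      funext i
      exact (hu i).symm
    rw [h2] at h1
    obtain ⟨w, hw, hwv⟩ := h1
    have h3 : v - w ∈ LinearMap.range j := by
      rw [hjp, LinearMap.mem_ker, map_sub, hwv, sub_self]
    have h4 : LinearMap.range j = Submodule.span K (Set.range fun i => j (b i)) := by
      rw [LinearMap.range_eq_map, ← b.span_eq, Submodule.map_span, ← Set.range_comp]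
      rfl
    rw [h4] at h3
    rw [← sub_add_cancel v w]
    exact Submodule.add_mem_sup h3 hw
  exact ⟨Basis.mk hli hsp, fun i => by simp, fun i => by simp⟩

open Module in
/-- Block triangular determinants of adapted bases. -/
theorem Module.Basis.det_eq_mul_det_of_exact {K V V' V'' ι κ : Type*} [Field K]
    [AddCommGroup V] [Module K V] [AddCommGroup V'] [Module K V'] [AddCommGroup V'']
    [Module K V''] [Fintype ι] [DecidableEq ι] [Fintype κ] [DecidableEq κ]
    {j : V' →ₗ[K] V} {p : V →ₗ[K] V''} (hpj : ∀ v, p (j v) = 0)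
    (b b' : Basis ι K V') (c c' : Basis κ K V'') (e e' : Basis (ι ⊕ κ) K V)
    (he : ∀ i, e (Sum.inl i) = j (b i)) (hec : ∀ i, p (e (Sum.inr i)) = c i)
    (he' : ∀ i, e' (Sum.inl i) = j (b' i)) (hec' : ∀ i, p (e' (Sum.inr i)) = c' i) :
    e.det e' = b.det b' * c.det c' := by
  have hp : ∀ v k, e.repr v (Sum.inr k) = c.repr (p v) k := by
    intro v k
    have h := congrArg p (e.sum_repr v)
    rw [map_sum, Fintype.sum_sum_type] at h
    simp only [map_smul, he, hec, hpj, smul_zero, Finset.sum_const_zero, zero_add] at h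
    rw [← h, c.repr_sum_self]
  have hb : ∀ v i, e.repr (j v) (Sum.inl i) = b.repr v i := by
    intro v i
    conv_lhs => rw [← b.sum_repr v]
    simp only [map_sum, map_smul, ← he, Basis.repr_self]
    classical
    simp [Finsupp.single_apply]
  have : e.toMatrix e' = Matrix.fromBlocks (b.toMatrix b')
      (Matrix.of fun i k => e.repr (e' (Sum.inr k)) (Sum.inl i)) 0 (c.toMatrix c') := by
    ext (i | i) (k | k)
    · simp [Basis.toMatrix_apply, he', hb]
    · simp [Basis.toMatrix_apply]
    · simp [Basis.toMatrix_apply, he', hp, hpj]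
    · simp [Basis.toMatrix_apply, hp, hec']
  rw [Basis.det_apply, this, Matrix.det_fromBlocks_zero₂₁, ← Basis.det_apply, ← Basis.det_apply]

/-! ### Lattices at the points of a curve and their degree. -/

/-- The local rings of a curve inside its function field `K`, with their orders of vanishing and
the degrees of the points. -/
structure OrderSystem (K X : Type*) [Field K] where
  ring : X → Subring K
  isPrincipalIdealRing : ∀ x, IsPrincipalIdealRing (ring x)
  isFractionRing : ∀ x, IsFractionRing (ring x) K
  ord : X → K → ℤ
  ord_mul : ∀ x {f g : K}, f ≠ 0 → g ≠ 0 → ord x (f * g) = ord x f + ord x g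
  ord_nonneg : ∀ x {f : K}, f ≠ 0 → f ∈ ring x → 0 ≤ ord x f
  finite_notMem : ∀ f, {x | f ∉ ring x}.Finite
  weight : X → ℕ

namespace OrderSystem

open Module Submodule

variable {K X : Type*} [Field K] (S : OrderSystem K X)

attribute [instance] isPrincipalIdealRing isFractionRing

theorem ord_one (x : X) : S.ord x 1 = 0 := by
  have := S.ord_mul x (one_ne_zero (α := K)) one_ne_zero
  simpa using this

theorem ord_eq_zero_of_mul_eq_one (x : X) {f g : K} (hf : f ∈ S.ring x) (hg : g ∈ S.ring x)
    (h : f * g = 1) : S.ord x f = 0 := by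
  have hf0 : f ≠ 0 := left_ne_zero_of_mul_eq_one h
  have hg0 : g ≠ 0 := right_ne_zero_of_mul_eq_one h
  have h1 := S.ord_mul x hf0 hg0
  rw [h, ord_one] at h1
  have h2 := S.ord_nonneg x hf0 hf
  have h3 := S.ord_nonneg x hg0 hg
  omega

variable {V : Type*} [AddCommGroup V] [Module K V]
variable {ι κ : Type*} [Fintype ι] [DecidableEq ι] [Fintype κ] [DecidableEq κ]

theorem det_mem {x : X} (b : Basis ι K V) {v : ι → V}
    (hv : ∀ i, v i ∈ span (S.ring x) (Set.range b)) : b.det v ∈ S.ring x := by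
  choose g hg using fun i => (mem_span_range_iff_exists_fun (S.ring x)).1 (hv i)
  have : b.toMatrix v = (S.ring x).subtype.mapMatrix (Matrix.of fun i k => g k i) := by
    ext i k
    have h : v k = ∑ j, (g k j : K) • b j := (hg k).symm
    simp only [Basis.toMatrix_apply, RingHom.mapMatrix_apply, Matrix.map_apply, Matrix.of_apply]
    rw [h, b.repr_sum_self]
    rfl
  rw [Basis.det_apply, this, ← RingHom.map_det]
  exact Subtype.property _

/-- The two transition matrices have entries in the local ring and inverse determinants, so the
determinant is a unit there. -/
theorem ord_det_eq_zero {x : X} (b b' : Basis ι K V)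
    (h : span (S.ring x) (Set.range b) = span (S.ring x) (Set.range b')) :
    S.ord x (b.det b') = 0 := by
  refine S.ord_eq_zero_of_mul_eq_one x (g := b'.det b) (S.det_mem _ fun i => ?_)
    (S.det_mem _ fun i => ?_) ?_
  · rw [h]; exact subset_span ⟨i, rfl⟩
  · rw [← h]; exact subset_span ⟨i, rfl⟩
  · rw [Basis.det_mul_det, Basis.det_self]

omit [Fintype ι] [DecidableEq ι] in
-- A lattice is finitely generated and torsion-free over a principal ideal domain, hence free, and
-- its basis is a basis of the ambient space. The basis `e` only serves to fix the index type.
theorem exists_basis_span_eq {x : X} (Λ : Submodule (S.ring x) V) [IsLattice K Λ]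
    (e : Basis ι K V) : ∃ b : Basis ι K V, span (S.ring x) (Set.range b) = Λ := by
  have : Module.IsTorsionFree (S.ring x) K := inferInstance
  let b₀ := Module.Free.chooseBasis (S.ring x) Λ
  let b := b₀.extendOfIsLattice K
  refine ⟨b.reindex (b.indexEquiv e), ?_⟩
  rw [Basis.range_reindex]
  have : Set.range b = Λ.subtype '' (Set.range b₀) := by
    rw [← Set.range_comp]
    congr 1
    funext i
    simp [b]
  rw [this, ← map_span, b₀.span_eq, Submodule.map_top, range_subtype]

open Classical in
/-- The order at `x` of the determinant of a basis `a` with respect to a lattice `Λ`. -/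
noncomputable def order (x : X) (Λ : Submodule (S.ring x) V) (a : Basis ι K V) : ℤ :=
  -- The value 0 is never taken for a lattice, by `exists_basis_span_eq`.
  if h : ∃ b : Basis ι K V, span (S.ring x) (Set.range b) = Λ then S.ord x (h.choose.det a) else 0

theorem det_basis_ne_zero (b a : Basis ι K V) : b.det a ≠ 0 :=
  (b.isUnit_det a).ne_zero

theorem order_eq {x : X} {Λ : Submodule (S.ring x) V} (a b : Basis ι K V)
    (hb : span (S.ring x) (Set.range b) = Λ) : S.order x Λ a = S.ord x (b.det a) := by
  have h : ∃ b : Basis ι K V, span (S.ring x) (Set.range b) = Λ := ⟨b, hb⟩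
  rw [order, dif_pos h, ← Basis.det_mul_det b h.choose a,
    S.ord_mul x (det_basis_ne_zero _ _) (det_basis_ne_zero _ _),
    S.ord_det_eq_zero b h.choose (by rw [hb, h.choose_spec]), zero_add]

theorem order_span (x : X) (a : Basis ι K V) :
    S.order x (span (S.ring x) (Set.range a)) a = 0 := by
  rw [S.order_eq a a rfl, Basis.det_self, ord_one]

theorem order_change (x : X) (Λ : Submodule (S.ring x) V) [IsLattice K Λ] (a a' : Basis ι K V) :
    S.order x Λ a' = S.order x Λ a + S.ord x (a.det a') := by
  obtain ⟨b, hb⟩ := S.exists_basis_span_eq Λ a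
  rw [S.order_eq a b hb, S.order_eq a' b hb, ← S.ord_mul x (det_basis_ne_zero _ _)
    (det_basis_ne_zero _ _), Basis.det_mul_det]

theorem order_reindex (x : X) (Λ : Submodule (S.ring x) V) [IsLattice K Λ] (a : Basis ι K V)
    (e : ι ≃ κ) : S.order x Λ (a.reindex e) = S.order x Λ a := by
  obtain ⟨b, hb⟩ := S.exists_basis_span_eq Λ a
  rw [S.order_eq a b hb, S.order_eq (a.reindex e) (b.reindex e) (by rw [Basis.range_reindex, hb]),
    Basis.det_reindex]
  congr 2
  funext i
  simp

theorem order_mono {x : X} {Λ Λ' : Submodule (S.ring x) V} [IsLattice K Λ] [IsLattice K Λ']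
    (h : Λ ≤ Λ') (a : Basis ι K V) : S.order x Λ a ≤ S.order x Λ' a := by
  obtain ⟨b, hb⟩ := S.exists_basis_span_eq Λ a
  obtain ⟨b', hb'⟩ := S.exists_basis_span_eq Λ' a
  rw [S.order_eq a b hb, S.order_eq a b' hb', ← Basis.det_mul_det b' b a, S.ord_mul x
    (det_basis_ne_zero _ _) (det_basis_ne_zero _ _)]
  have := S.ord_nonneg x (det_basis_ne_zero b' b) (S.det_mem b' fun i => ?_)
  · omega
  · rw [hb']; apply h; rw [← hb]; exact subset_span ⟨i, rfl⟩

/-- A family of lattices, one for each point, almost all of which are spanned by a fixed basis. -/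
structure IsLatticeFamily [Module.Finite K V] (L : ∀ x, Submodule (S.ring x) V) : Prop where
  isLattice : ∀ x, IsLattice K (L x)
  finite : ∃ a : Basis (Fin (finrank K V)) K V, {x | L x ≠ span (S.ring x) (Set.range a)}.Finite

omit [DecidableEq ι] in
-- The finitely many entries of the two transition matrices lie in the local ring at almost every
-- point.
theorem finite_span_ne (a a' : Basis ι K V) :
    {x | span (S.ring x) (Set.range a) ≠ span (S.ring x) (Set.range a')}.Finite := by
  have key : ∀ b b' : Basis ι K V,
      {x | ¬ span (S.ring x) (Set.range b) ≤ span (S.ring x) (Set.range b')}.Finite := by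
    intro b b'
    refine (Set.finite_iUnion fun i : ι => Set.finite_iUnion fun k : ι =>
      S.finite_notMem (b'.repr (b i) k)).subset ?_
    intro x hx
    by_contra hcon
    simp only [Set.mem_iUnion, Set.mem_ofPred_eq, not_exists, not_not] at hcon
    refine hx (span_le.2 ?_)
    rintro _ ⟨i, rfl⟩
    rw [← b'.sum_repr (b i)]
    exact sum_mem fun k _ => smul_mem _ (⟨_, hcon i k⟩ : S.ring x) (subset_span ⟨k, rfl⟩)
  refine ((key a a').union (key a' a)).subset ?_
  intro x hx
  by_contra hcon
  simp only [Set.mem_union, Set.mem_ofPred_eq, not_or, not_not] at hcon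
  exact hx (le_antisymm hcon.1 hcon.2)

variable {S}

omit [DecidableEq ι] in
theorem IsLatticeFamily.finite_ne [Module.Finite K V] {L : ∀ x, Submodule (S.ring x) V}
    (hL : S.IsLatticeFamily L) (a : Basis ι K V) :
    {x | L x ≠ span (S.ring x) (Set.range a)}.Finite := by
  obtain ⟨b, hb⟩ := hL.finite
  let b' : Basis ι K V := b.reindex (b.indexEquiv a)
  refine (hb.union (S.finite_span_ne b' a)).subset ?_
  intro x hx
  by_contra hcon
  simp only [Set.mem_union, Set.mem_ofPred_eq, not_or, not_not] at hcon
  rw [Basis.range_reindex] at hcon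
  exact hx (hcon.1.trans hcon.2)

theorem IsLatticeFamily.finite_order [Module.Finite K V] {L : ∀ x, Submodule (S.ring x) V}
    (hL : S.IsLatticeFamily L) (a : Basis ι K V) :
    (Function.support fun x => S.order x (L x) a * (S.weight x : ℤ)).Finite := by
  refine (hL.finite_ne a).subset fun x hx h => hx ?_
  simp only [h, S.order_span, zero_mul]

variable (S) in
/-- The degree of a family of lattices. -/
noncomputable def deg [Module.Finite K V] (L : ∀ x, Submodule (S.ring x) V) : ℤ :=
  ∑ᶠ x, S.order x (L x) (finBasis K V) * (S.weight x : ℤ)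

variable (S) in
/-- Principal divisors have degree zero. -/
def PrincipalDegreeZero : Prop :=
  ∀ f : K, f ≠ 0 → ∑ᶠ x, S.ord x f * (S.weight x : ℤ) = 0

variable (S) in
theorem finite_ord {f : K} (hf : f ≠ 0) :
    (Function.support fun x => S.ord x f * (S.weight x : ℤ)).Finite := by
  refine ((S.finite_notMem f).union (S.finite_notMem f⁻¹)).subset fun x hx => ?_
  by_contra hcon
  simp only [Set.mem_union, Set.mem_ofPred_eq, not_or, not_not] at hcon
  refine hx ?_
  simp only [S.ord_eq_zero_of_mul_eq_one x hcon.1 hcon.2 (mul_inv_cancel₀ hf), zero_mul]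

theorem IsLatticeFamily.finsum_order_change [Module.Finite K V]
    {L : ∀ x, Submodule (S.ring x) V} (hL : S.IsLatticeFamily L) (a a' : Basis ι K V) :
    ∑ᶠ x, S.order x (L x) a' * (S.weight x : ℤ) =
      ∑ᶠ x, S.order x (L x) a * (S.weight x : ℤ) + ∑ᶠ x, S.ord x (a.det a') * (S.weight x : ℤ) := by
  rw [← finsum_add_distrib (hL.finite_order a) (S.finite_ord (det_basis_ne_zero a a'))]
  refine finsum_congr fun x => ?_
  have := hL.isLattice x
  rw [S.order_change x (L x) a a', add_mul]

/-- Changing the basis adds the degree of the principal divisor of the transition determinant, which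
is 0. -/
theorem IsLatticeFamily.deg_eq [Module.Finite K V] (hS : S.PrincipalDegreeZero)
    {L : ∀ x, Submodule (S.ring x) V} (hL : S.IsLatticeFamily L) (a : Basis ι K V) :
    S.deg L = ∑ᶠ x, S.order x (L x) a * (S.weight x : ℤ) := by
  let e := (finBasis K V).indexEquiv a
  have h := hL.finsum_order_change ((finBasis K V).reindex e) a
  rw [hS _ (det_basis_ne_zero _ _), add_zero] at h
  rw [h, deg]
  refine finsum_congr fun x => ?_
  have := hL.isLattice x
  rw [S.order_reindex]

theorem deg_mono [Module.Finite K V] {L L' : ∀ x, Submodule (S.ring x) V}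
    (hL : S.IsLatticeFamily L) (hL' : S.IsLatticeFamily L') (h : ∀ x, L x ≤ L' x) :
    S.deg L ≤ S.deg L' := by
  refine finsum_le_finsum' (hL.finite_order _) (hL'.finite_order _) fun x => ?_
  have := hL.isLattice x
  have := hL'.isLattice x
  exact mul_le_mul_of_nonneg_right (S.order_mono (h x) _) (by positivity)

/-! ### Additivity of the degree in exact sequences. -/

section Exact

variable {V' V'' : Type*} [AddCommGroup V'] [Module K V'] [AddCommGroup V''] [Module K V'']
  {j : V' →ₗ[K] V} {p : V →ₗ[K] V''}

variable (S) in
-- Finite generation holds because the lattice is noetherian; spanning holds because every vector is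
-- carried into the lattice by a nonzero element of the local ring.
theorem isLattice_comap {x : X} (Λ : Submodule (S.ring x) V) [IsLattice K Λ]
    (hj : Function.Injective j) : IsLattice K (Λ.comap (j.restrictScalars (S.ring x))) where
  fg := by
    have h1 : Module.Finite (S.ring x) Λ := IsLattice.finite K Λ
    have h2 : IsNoetherian (S.ring x) Λ := inferInstance
    rw [← Module.Finite.iff_fg]
    let f : Λ.comap (j.restrictScalars (S.ring x)) →ₗ[S.ring x] Λ :=
      (j.restrictScalars (S.ring x)).restrict fun v hv => hv
    refine Module.Finite.of_injective f fun a b hab => ?_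
    exact Subtype.ext (hj (congrArg Subtype.val hab))
  span_eq_top := by
    rw [eq_top_iff]
    rintro v -
    have hv : j v ∈ span K (Λ : Set V) := by rw [IsLattice.span_eq_top]; trivial
    have : ∃ r : S.ring x, r ≠ 0 ∧ r • j v ∈ Λ := by
      generalize j v = w at hv
      induction hv using Submodule.span_induction with
      | mem w hw => exact ⟨1, one_ne_zero, by simpa using hw⟩
      | zero => exact ⟨1, one_ne_zero, by simp⟩
      | add w w' _ _ h h' =>
        obtain ⟨r, hr, hrw⟩ := h
        obtain ⟨r', hr', hrw'⟩ := h'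
        refine ⟨r * r', mul_ne_zero hr hr', ?_⟩
        rw [smul_add]
        refine add_mem ?_ ?_
        · rw [mul_comm, mul_smul]; exact smul_mem _ _ hrw
        · rw [mul_smul]; exact smul_mem _ _ hrw'
      | smul c w _ h =>
        obtain ⟨r, hr, hrw⟩ := h
        obtain ⟨a, b, hb, rfl⟩ := IsFractionRing.div_surjective (A := S.ring x) c
        have hb0 : b ≠ 0 := nonZeroDivisors.ne_zero hb
        refine ⟨b * r, mul_ne_zero hb0 hr, ?_⟩
        have : (b * r) • (algebraMap (S.ring x) K a / algebraMap (S.ring x) K b) • w =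
            a • r • w := by
          have hb' : (b : K) ≠ 0 := fun h => hb0 (Subtype.ext h)
          change ((b : K) * (r : K)) • ((a : K) / (b : K)) • w = (a : K) • (r : K) • w
          rw [smul_smul, smul_smul]
          congr 1
          field_simp
        rw [this]
        exact smul_mem _ _ hrw
    obtain ⟨r, hr, hrv⟩ := this
    have hr' : (r : K) ≠ 0 := fun h => hr (Subtype.ext h)
    have h1 : (r : K) • v ∈ span K ((Λ.comap (j.restrictScalars (S.ring x)) :
        Submodule (S.ring x) V') : Set V') := by
      refine subset_span ?_
      change j ((r : K) • v) ∈ Λ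
      rw [map_smul]
      exact hrv
    have := smul_mem _ (r : K)⁻¹ h1
    rwa [smul_smul, inv_mul_cancel₀ hr', one_smul] at this

variable (S) in
theorem isLattice_map {x : X} (Λ : Submodule (S.ring x) V) [IsLattice K Λ]
    (hp : Function.Surjective p) : IsLattice K (Λ.map (p.restrictScalars (S.ring x))) where
  fg := (IsLattice.fg (M := Λ)).map _
  span_eq_top := by
    have : ((Λ.map (p.restrictScalars (S.ring x)) : Submodule (S.ring x) V'') : Set V'') =
        p '' (Λ : Set V) := rfl
    rw [this, ← map_span, IsLattice.span_eq_top, Submodule.map_top, LinearMap.range_eq_top.2 hp]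

variable (S) in
omit [Fintype ι] [DecidableEq ι] [Fintype κ] [DecidableEq κ] in
/-- A lattice has a basis adapted to an exact sequence. -/
theorem exists_adapted_basis {x : X} (Λ : Submodule (S.ring x) V) [IsLattice K Λ]
    (hj : Function.Injective j) (hjp : LinearMap.range j = LinearMap.ker p)
    (hp : Function.Surjective p) (b₀ : Basis ι K V') (c₀ : Basis κ K V'') :
    ∃ (b : Basis ι K V') (c : Basis κ K V'') (e : Basis (ι ⊕ κ) K V),
      (∀ i, e (Sum.inl i) = j (b i)) ∧ (∀ i, p (e (Sum.inr i)) = c i) ∧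
      span (S.ring x) (Set.range e) = Λ ∧
      span (S.ring x) (Set.range b) = Λ.comap (j.restrictScalars (S.ring x)) ∧
      span (S.ring x) (Set.range c) = Λ.map (p.restrictScalars (S.ring x)) := by
  have := S.isLattice_comap Λ hj
  have := S.isLattice_map Λ hp
  obtain ⟨b, hb⟩ := S.exists_basis_span_eq (Λ.comap (j.restrictScalars (S.ring x))) b₀
  obtain ⟨c, hc⟩ := S.exists_basis_span_eq (Λ.map (p.restrictScalars (S.ring x))) c₀
  -- The image lattice is free, so the sequence of lattices splits: the `c i` are lifted inside `Λ`.
  have hc' : ∀ i, ∃ u ∈ Λ, p u = c i := fun i => by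
    have : c i ∈ span (S.ring x) (Set.range c) := subset_span ⟨i, rfl⟩
    rw [hc] at this
    exact this
  choose u huΛ hu using hc'
  obtain ⟨e, he, he'⟩ := Module.Basis.exists_sum_of_exact hj hjp b c u hu
  refine ⟨b, c, e, he, fun i => by rw [he', hu], le_antisymm ?_ ?_, hb, hc⟩
  · rw [span_le]
    rintro _ ⟨i | i, rfl⟩
    · have : b i ∈ span (S.ring x) (Set.range b) := subset_span ⟨i, rfl⟩
      rw [hb] at this
      rw [he]
      exact this
    · rw [he']; exact huΛ i
  · intro v hv
    have h1 : p v ∈ span (S.ring x) (Set.range c) := by rw [hc]; exact ⟨v, hv, rfl⟩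
    have h2 : span (S.ring x) (Set.range c) =
        (span (S.ring x) (Set.range u)).map (p.restrictScalars (S.ring x)) := by
      rw [map_span, ← Set.range_comp]
      congr 2
      funext i
      exact (hu i).symm
    rw [h2] at h1
    obtain ⟨w, hw, hwv⟩ := h1
    have hwΛ : w ∈ Λ := by
      have : span (S.ring x) (Set.range u) ≤ Λ := by
        rw [span_le]; rintro _ ⟨i, rfl⟩; exact huΛ i
      exact this hw
    have hwe : span (S.ring x) (Set.range u) ≤ span (S.ring x) (Set.range e) := by
      refine span_mono ?_
      rintro _ ⟨i, rfl⟩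
      exact ⟨Sum.inr i, he' i⟩
    have h3 : v - w ∈ LinearMap.range j := by
      rw [hjp, LinearMap.mem_ker, map_sub, sub_eq_zero]; exact hwv.symm
    obtain ⟨z, hz⟩ := h3
    have hzb : z ∈ span (S.ring x) (Set.range b) := by
      rw [hb]
      change j z ∈ Λ
      rw [hz]
      exact sub_mem hv hwΛ
    have hbe : span (S.ring x) (Set.range b) ≤
        (span (S.ring x) (Set.range e)).comap (j.restrictScalars (S.ring x)) := by
      rw [span_le]
      rintro _ ⟨i, rfl⟩
      change j (b i) ∈ span (S.ring x) (Set.range e)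
      rw [← he]
      exact subset_span ⟨_, rfl⟩
    have h4 : v - w ∈ span (S.ring x) (Set.range e) := by
      rw [← hz]; exact hbe hzb
    rw [← sub_add_cancel v w]
    exact add_mem h4 (hwe hw)

/-- The order of an adapted basis is the sum of the orders of its two parts. -/
theorem order_exact {x : X} (Λ : Submodule (S.ring x) V) [IsLattice K Λ]
    (hj : Function.Injective j) (hjp : LinearMap.range j = LinearMap.ker p)
    (hp : Function.Surjective p) (b : Basis ι K V') (c : Basis κ K V'')
    (e : Basis (ι ⊕ κ) K V) (he : ∀ i, e (Sum.inl i) = j (b i))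
    (hec : ∀ i, p (e (Sum.inr i)) = c i) :
    S.order x Λ e = S.order x (Λ.comap (j.restrictScalars (S.ring x))) b +
      S.order x (Λ.map (p.restrictScalars (S.ring x))) c := by
  obtain ⟨b', c', e', h1, h2, h3, h4, h5⟩ := S.exists_adapted_basis Λ hj hjp hp b c
  have hpj : ∀ v, p (j v) = 0 := fun v => by
    rw [← LinearMap.mem_ker, ← hjp]; exact ⟨v, rfl⟩
  rw [S.order_eq e e' h3, S.order_eq b b' h4, S.order_eq c c' h5,
    Module.Basis.det_eq_mul_det_of_exact hpj b' b c' c e' e h1 h2 he hec,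
    S.ord_mul x (det_basis_ne_zero _ _) (det_basis_ne_zero _ _)]

omit [DecidableEq ι] [DecidableEq κ] in
-- This handles the points where the lattice is spanned by the fixed adapted basis, that is, almost
-- all of them.
theorem span_adapted {x : X} (hj : Function.Injective j)
    (hjp : LinearMap.range j = LinearMap.ker p) (b : Basis ι K V') (c : Basis κ K V'')
    (e : Basis (ι ⊕ κ) K V) (he : ∀ i, e (Sum.inl i) = j (b i))
    (hec : ∀ i, p (e (Sum.inr i)) = c i) :
    (span (S.ring x) (Set.range e)).comap (j.restrictScalars (S.ring x)) =
        span (S.ring x) (Set.range b) ∧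
      (span (S.ring x) (Set.range e)).map (p.restrictScalars (S.ring x)) =
        span (S.ring x) (Set.range c) := by
  have hpj : ∀ v, p (j v) = 0 := fun v => by
    rw [← LinearMap.mem_ker, ← hjp]; exact ⟨v, rfl⟩
  constructor
  · refine le_antisymm ?_ ?_
    · intro v hv
      change j v ∈ span (S.ring x) (Set.range e) at hv
      rw [mem_span_range_iff_exists_fun] at hv ⊢
      obtain ⟨g, hg⟩ := hv
      refine ⟨fun i => g (Sum.inl i), hj ?_⟩
      have h0 : ∑ k, g (Sum.inr k) • c k = 0 := by
        have := congrArg p hg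
        rw [hpj, map_sum, Fintype.sum_sum_type] at this
        have h1 : ∀ i, p (g (Sum.inl i) • e (Sum.inl i)) = 0 := fun i => by
          change p ((g (Sum.inl i) : K) • e (Sum.inl i)) = 0
          rw [map_smul, he, hpj, smul_zero]
        have h2 : ∀ k, p (g (Sum.inr k) • e (Sum.inr k)) = g (Sum.inr k) • c k := fun k => by
          change p ((g (Sum.inr k) : K) • e (Sum.inr k)) = (g (Sum.inr k) : K) • c k
          rw [map_smul, hec]
        simpa only [h1, h2, Finset.sum_const_zero, zero_add] using this
      have h3 : ∀ k, g (Sum.inr k) = 0 := fun k =>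
        Subtype.ext (Fintype.linearIndependent_iff.1 c.linearIndependent
          (fun k => (g (Sum.inr k) : K)) h0 k)
      rw [← hg, Fintype.sum_sum_type, map_sum]
      simp only [h3, zero_smul, Finset.sum_const_zero, add_zero]
      refine Finset.sum_congr rfl fun i _ => ?_
      change j ((g (Sum.inl i) : K) • b i) = (g (Sum.inl i) : K) • e (Sum.inl i)
      rw [map_smul, he]
    · rw [span_le]
      rintro _ ⟨i, rfl⟩
      change j (b i) ∈ span (S.ring x) (Set.range e)
      rw [← he]
      exact subset_span ⟨_, rfl⟩
  · rw [map_span]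
    refine le_antisymm (span_le.2 ?_) (span_mono ?_)
    · rintro _ ⟨_, ⟨i | i, rfl⟩, rfl⟩
      · change p (e _) ∈ span (S.ring x) (Set.range c)
        rw [he, hpj]
        exact zero_mem _
      · change p (e _) ∈ span (S.ring x) (Set.range c)
        rw [hec]
        exact subset_span ⟨_, rfl⟩
    · rintro _ ⟨i, rfl⟩
      exact ⟨_, ⟨_, rfl⟩, hec i⟩

omit [Fintype ι] [DecidableEq ι] [Fintype κ] [DecidableEq κ] in
theorem IsLatticeFamily.exact [Module.Finite K V] [Module.Finite K V'] [Module.Finite K V'']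
    {L : ∀ x, Submodule (S.ring x) V} (hL : S.IsLatticeFamily L)
    (hj : Function.Injective j) (hjp : LinearMap.range j = LinearMap.ker p)
    (hp : Function.Surjective p) :
    S.IsLatticeFamily (fun x => (L x).comap (j.restrictScalars (S.ring x))) ∧
      S.IsLatticeFamily (fun x => (L x).map (p.restrictScalars (S.ring x))) := by
  let b := finBasis K V'
  let c := finBasis K V''
  obtain ⟨e, he, he'⟩ := Module.Basis.exists_sum_of_exact hj hjp b c _
    fun i => Function.surjInv_eq hp (c i)
  have hec : ∀ i, p (e (Sum.inr i)) = c i := fun i => by rw [he', Function.surjInv_eq hp]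
  refine ⟨⟨fun x => ?_, b, (hL.finite_ne e).subset fun x hx h => hx ?_⟩,
    ⟨fun x => ?_, c, (hL.finite_ne e).subset fun x hx h => hx ?_⟩⟩
  · have := hL.isLattice x
    exact S.isLattice_comap (L x) hj
  · rw [h, (span_adapted hj hjp b c e he hec).1]
  · have := hL.isLattice x
    exact S.isLattice_map (L x) hp
  · rw [h, (span_adapted hj hjp b c e he hec).2]

omit [Fintype ι] [DecidableEq ι] [Fintype κ] [DecidableEq κ] in
/-- Degrees are additive in exact sequences. -/
theorem IsLatticeFamily.deg_exact [Module.Finite K V] [Module.Finite K V'] [Module.Finite K V'']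
    (hS : S.PrincipalDegreeZero) {L : ∀ x, Submodule (S.ring x) V} (hL : S.IsLatticeFamily L)
    (hj : Function.Injective j) (hjp : LinearMap.range j = LinearMap.ker p)
    (hp : Function.Surjective p) :
    S.deg L = S.deg (fun x => (L x).comap (j.restrictScalars (S.ring x))) +
      S.deg (fun x => (L x).map (p.restrictScalars (S.ring x))) := by
  let b := finBasis K V'
  let c := finBasis K V''
  obtain ⟨e, he, he'⟩ := Module.Basis.exists_sum_of_exact hj hjp b c _
    fun i => Function.surjInv_eq hp (c i)
  have hec : ∀ i, p (e (Sum.inr i)) = c i := fun i => by rw [he', Function.surjInv_eq hp]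
  obtain ⟨h1, h2⟩ := hL.exact hj hjp hp
  rw [hL.deg_eq hS e, deg, deg, ← finsum_add_distrib (h1.finite_order _) (h2.finite_order _)]
  refine finsum_congr fun x => ?_
  have := hL.isLattice x
  rw [order_exact (L x) hj hjp hp b c e he hec, add_mul]

end Exact

/-- The family of lattices induced on a subspace. -/
def sub (L : ∀ x, Submodule (S.ring x) V) (T : Submodule K V) (x : X) :
    Submodule (S.ring x) T :=
  (L x).comap (T.subtype.restrictScalars (S.ring x))

theorem IsLatticeFamily.sub [Module.Finite K V] {L : ∀ x, Submodule (S.ring x) V}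
    (hL : S.IsLatticeFamily L) (T : Submodule K V) : S.IsLatticeFamily (sub L T) :=
  (hL.exact (j := T.subtype) (p := T.mkQ) T.subtype_injective (by simp)
    T.mkQ_surjective).1

/-- If `f` maps lattices to lattices and induces an isomorphism `A / A' ≅ B / B'` of subquotients,
then the degree of `A / A'` is at most that of `B / B'`. -/
theorem IsLatticeFamily.deg_sub_add_deg_sub_le {W : Type*} [AddCommGroup W] [Module K W]
    [Module.Finite K V] [Module.Finite K W] (hS : S.PrincipalDegreeZero)
    {L : ∀ x, Submodule (S.ring x) V} {M : ∀ x, Submodule (S.ring x) W}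
    (hL : S.IsLatticeFamily L) (hM : S.IsLatticeFamily M) (f : V →ₗ[K] W)
    (hf : ∀ x, ∀ v ∈ L x, f v ∈ M x) (A A' : Submodule K V) (B B' : Submodule K W)
    (hA : A' = A ⊓ B'.comap f) (hB : B = B' ⊔ A.map f) :
    S.deg (OrderSystem.sub L A) + S.deg (OrderSystem.sub M B') ≤
      S.deg (OrderSystem.sub L A') + S.deg (OrderSystem.sub M B) := by
  have hA'A : A' ≤ A := hA ▸ inf_le_left
  have hB'B : B' ≤ B := hB ▸ le_sup_left
  have hfAB : ∀ v ∈ A, f v ∈ B := fun v hv => hB ▸ mem_sup_right ⟨v, hv, rfl⟩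
  let j := inclusion hA'A
  let i := inclusion hB'B
  let q := (LinearMap.range i).mkQ
  -- Both A/A' and B/B' are realised as the space (B modulo the range of `i`): `p` is onto it with
  -- kernel A', and `q` is onto it with kernel B'. The two degrees then compare lattices in one
  -- space.
  let p := q ∘ₗ f.restrict hfAB
  have hq : Function.Surjective q := mkQ_surjective _
  have hi : LinearMap.range i = LinearMap.ker q := by simp [q]
  have hp : Function.Surjective p := by
    intro z
    obtain ⟨⟨w, hw⟩, rfl⟩ := hq z
    have hw' := hw
    rw [hB, mem_sup] at hw'
    obtain ⟨y, hy, _, ⟨v, hv, rfl⟩, rfl⟩ := hw'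
    refine ⟨⟨v, hv⟩, ?_⟩
    change q _ = q _
    rw [← sub_eq_zero, ← map_sub, ← LinearMap.mem_ker, ← hi]
    refine ⟨⟨-y, neg_mem hy⟩, Subtype.ext ?_⟩
    change -y = f v - (y + f v)
    abel
  have hj : LinearMap.range j = LinearMap.ker p := by
    ext ⟨v, hv⟩
    have h1 : (⟨v, hv⟩ : A) ∈ LinearMap.ker p ↔ (f.restrict hfAB ⟨v, hv⟩) ∈ LinearMap.ker q :=
      Iff.rfl
    rw [h1, ← hi, range_inclusion, range_inclusion, mem_comap, mem_comap]
    change v ∈ A' ↔ f v ∈ B'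
    rw [hA]
    exact ⟨fun h => h.2, fun h => ⟨hv, h⟩⟩
  have e1 := (hL.sub A).deg_exact hS (inclusion_injective hA'A) hj hp
  have e2 := (hM.sub B).deg_exact hS (inclusion_injective hB'B) hi hq
  -- Since `f` maps `L x` into `M x`, the image of the lattice of A lies in the image of the lattice
  -- of B.
  have e3 : S.deg (fun x => (OrderSystem.sub L A x).map (p.restrictScalars (S.ring x))) ≤
      S.deg (fun x => (OrderSystem.sub M B x).map (q.restrictScalars (S.ring x))) := by
    refine deg_mono ((hL.sub A).exact (inclusion_injective hA'A) hj hp).2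
      ((hM.sub B).exact (inclusion_injective hB'B) hi hq).2 fun x => ?_
    rintro _ ⟨⟨v, hv⟩, hvL, rfl⟩
    exact ⟨⟨f v, hfAB v hv⟩, hf x v hvL, rfl⟩
  rw [show (fun x => (OrderSystem.sub L A x).comap (j.restrictScalars (S.ring x))) =
    OrderSystem.sub L A' from rfl] at e1
  rw [show (fun x => (OrderSystem.sub M B x).comap (i.restrictScalars (S.ring x))) =
    OrderSystem.sub M B' from rfl] at e2
  linarith

end OrderSystem

/-! ### Semistable chains of vector spaces with a degree function. -/

namespace Submodule

open Module

theorem finrank_map_add_finrank_inf_ker {K V W : Type*} [Field K] [AddCommGroup V] [Module K V]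
    [Module.Finite K V] [AddCommGroup W] [Module K W] (f : V →ₗ[K] W) (A : Submodule K V) :
    finrank K (A.map f) + finrank K (A ⊓ LinearMap.ker f : Submodule K V) = finrank K A := by
  have h := LinearMap.finrank_range_add_finrank_ker (f.domRestrict A)
  have h2 : A ⊓ LinearMap.ker f = (LinearMap.ker (f.domRestrict A)).map A.subtype := by
    rw [LinearMap.ker_domRestrict, map_comap_subtype]
  rw [LinearMap.range_domRestrict] at h
  rw [h2, (equivMapOfInjective _ A.subtype_injective _).symm.finrank_eq, h]

/-- The map `f` induces an isomorphism A/A' ≅ B/B'; this is the rank counterpart of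
`GradedChain.deg_le`. -/
theorem finrank_add_finrank_eq {K V W : Type*} [Field K] [AddCommGroup V] [Module K V]
    [Module.Finite K V] [AddCommGroup W] [Module K W] [Module.Finite K W] (f : V →ₗ[K] W)
    (A A' : Submodule K V) (B B' : Submodule K W)
    (hA : A' = A ⊓ B'.comap f) (hB : B = B' ⊔ A.map f) :
    finrank K A + finrank K B' = finrank K A' + finrank K B := by
  have h1 := finrank_map_add_finrank_inf_ker f A
  have h2 := finrank_map_add_finrank_inf_ker f A'
  have h3 := finrank_sup_add_finrank_inf_eq B' (A.map f)
  have h4 : A'.map f = B' ⊓ A.map f := by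
    rw [hA]
    ext w
    constructor
    · rintro ⟨v, ⟨hv, hv'⟩, rfl⟩
      exact ⟨hv', v, hv, rfl⟩
    · rintro ⟨hw, v, hv, rfl⟩
      exact ⟨v, ⟨hv, hw⟩, rfl⟩
  have h5 : A' ⊓ LinearMap.ker f = A ⊓ LinearMap.ker f := by
    rw [hA]
    ext v
    constructor
    · rintro ⟨⟨hv, -⟩, hv'⟩
      exact ⟨hv, hv'⟩
    · rintro ⟨hv, hv'⟩
      refine ⟨⟨hv, ?_⟩, hv'⟩
      rw [SetLike.mem_coe, mem_comap, LinearMap.mem_ker.1 hv']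
      exact zero_mem _
  rw [← hB] at h3
  rw [h4, h5] at h2
  omega

end Submodule

/-- A chain of finite-dimensional vector spaces with a degree function on subspaces which is
superadditive along the maps of the chain. -/
structure GradedChain (K : Type*) [Field K] (r : ℕ) where
  V : Fin (r + 1) → Type*
  [addCommGroup : ∀ i, AddCommGroup (V i)]
  [module : ∀ i, Module K (V i)]
  [finite : ∀ i, Module.Finite K (V i)]
  f : ∀ i : Fin r, V i.succ →ₗ[K] V i.castSucc
  deg : ∀ i, Submodule K (V i) → ℤ
  deg_bot : ∀ i, deg i ⊥ = 0
  deg_le : ∀ (i : Fin r) (A A' : Submodule K (V i.succ)) (B B' : Submodule K (V i.castSucc)),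
    A' = A ⊓ B'.comap (f i) → B = B' ⊔ A.map (f i) →
      deg i.succ A + deg i.castSucc B' ≤ deg i.succ A' + deg i.castSucc B

namespace GradedChain

open Module

attribute [instance] addCommGroup module finite

variable {K : Type*} [Field K] {r : ℕ} (E : GradedChain K r)

/-- A family of subspaces stable under the maps of the chain. -/
def IsStable (T : ∀ i, Submodule K (E.V i)) : Prop :=
  ∀ i : Fin r, (T i.succ).map (E.f i) ≤ T i.castSucc

/-- The contribution of a subspace to the excess of the slope over `μ`. -/
noncomputable def excess (α : Fin (r + 1) → ℝ) (μ : ℝ) (i : Fin (r + 1))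
    (T : Submodule K (E.V i)) : ℝ :=
  E.deg i T + (α i - μ) * finrank K T

/-- Every stable family of subspaces has slope at most the slope `μ` of the whole chain. -/
structure IsSemistable (α : Fin (r + 1) → ℝ) (μ : ℝ) : Prop where
  le : ∀ T, E.IsStable T → ∑ i, E.excess α μ i (T i) ≤ 0
  top : ∑ i, E.excess α μ i ⊤ = 0

variable {E} {α : Fin (r + 1) → ℝ} {μ : ℝ}

theorem excess_bot (i : Fin (r + 1)) : E.excess α μ i ⊥ = 0 := by
  simp [excess, E.deg_bot]

theorem IsSemistable.sum_Iic_le (h : E.IsSemistable α μ) (j : Fin (r + 1)) :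
    ∑ i ∈ Finset.Iic j, E.excess α μ i ⊤ ≤ 0 := by
  have := h.le (fun i => if i ≤ j then ⊤ else ⊥) ?_
  · refine le_trans (le_of_eq ?_) this
    rw [← Finset.sum_subset (Finset.subset_univ (Finset.Iic j))]
    · refine Finset.sum_congr rfl fun i hi => ?_
      rw [if_pos (Finset.mem_Iic.1 hi)]
    · intro i _ hi
      rw [if_neg (fun h => hi (Finset.mem_Iic.2 h)), excess_bot]
  · intro i
    dsimp only
    by_cases hi : i.succ ≤ j
    · rw [if_pos (le_trans (Fin.castSucc_le_succ i) hi)]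
      exact le_top
    · rw [if_neg hi, Submodule.map_bot]
      exact bot_le

/-- A subspace of the kernel is a stable family concentrated in one place. -/
theorem IsSemistable.excess_le_of_le_ker (h : E.IsSemistable α μ) (i : Fin r)
    (T : Submodule K (E.V i.succ)) (hT : T ≤ LinearMap.ker (E.f i)) :
    E.excess α μ i.succ T ≤ 0 := by
  have := h.le (Function.update (fun _ => ⊥) i.succ T) ?_
  · rwa [Finset.sum_eq_single i.succ, Function.update_self] at this
    · intro k _ hk
      rw [Function.update_of_ne hk, excess_bot]
    · simp
  · intro k
    by_cases hk : k = i
    · subst hk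
      rw [Function.update_self, LinearMap.le_ker_iff_map.1 hT]
      exact bot_le
    · rw [Function.update_of_ne (fun h => hk (Fin.succ_injective _ h)), Submodule.map_bot]
      exact bot_le

/-- A subspace containing the image is a stable family differing from the chain in one place. -/
theorem IsSemistable.excess_le_of_range_le (h : E.IsSemistable α μ) (i : Fin r)
    (T : Submodule K (E.V i.castSucc)) (hT : LinearMap.range (E.f i) ≤ T) :
    E.excess α μ i.castSucc T ≤ E.excess α μ i.castSucc ⊤ := by
  have h1 := h.le (Function.update (fun _ => ⊤) i.castSucc T) ?_
  · rw [← h.top, ← sub_nonpos, ← Finset.sum_sub_distrib, Finset.sum_eq_single i.castSucc,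
      Function.update_self] at h1
    · linarith
    · intro k _ hk
      rw [Function.update_of_ne hk, sub_self]
    · simp
  · intro k
    by_cases hk : k = i
    · subst hk
      rw [Function.update_self]
      exact LinearMap.map_le_range.trans hT
    · rw [Function.update_of_ne (fun h => hk (Fin.castSucc_injective _ h))]
      exact le_top

/-- Semistability is tested on the family equal to the image of V_j at the places k ≤ i ≤ j and to
everything elsewhere; an induction then trades the images for V_j itself. -/
theorem IsSemistable.sum_Icc_nonneg (h : E.IsSemistable α μ) (hα : Monotone α)
    (k j : Fin (r + 1)) :
    0 ≤ ∑ i ∈ Finset.Icc k j, ((E.deg i ⊤ : ℝ) - E.deg j ⊤ +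
      (α i - μ) * ((finrank K (E.V i) : ℝ) - finrank K (E.V j))) := by
  let T : ∀ i, Submodule K (E.V i) := Fin.reverseInduction ⊤
    fun i U => if k ≤ i.castSucc ∧ i.succ ≤ j then U.map (E.f i) else ⊤
  have hT0 : T (Fin.last r) = ⊤ := Fin.reverseInduction_last ..
  have hT : ∀ i : Fin r, T i.castSucc =
      if k ≤ i.castSucc ∧ i.succ ≤ j then (T i.succ).map (E.f i) else ⊤ :=
    fun i => Fin.reverseInduction_castSucc ..
  have hstable : E.IsStable T := by
    intro i
    rw [hT]
    split_ifs
    · exact le_rfl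
    · exact le_top
  have hout : ∀ i, i ∉ Finset.Icc k j → T i = ⊤ := by
    intro i hi
    rw [Finset.mem_Icc] at hi
    induction i using Fin.lastCases with
    | last => exact hT0
    | cast i =>
      rw [hT, if_neg]
      rintro ⟨h1, h2⟩
      exact hi ⟨h1, (Fin.castSucc_le_succ i).trans h2⟩
  -- Descending induction from j, where equality holds. The rank bound is carried along because it
  -- gives the sign of the error when α_{i+1} is replaced by α_i.
  have key : ∀ i, k ≤ i → i ≤ j → finrank K (T i) ≤ finrank K (E.V j) ∧
      0 ≤ (E.deg i (T i) : ℝ) - E.deg j ⊤ +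
        (α i - μ) * ((finrank K (T i) : ℝ) - finrank K (E.V j)) := by
    intro i
    induction i using Fin.reverseInduction with
    | last =>
      intro _ hj
      obtain rfl := Fin.last_le_iff.1 hj
      rw [hT0]
      simp
    | cast i ih =>
      intro hk hj
      rcases hj.eq_or_lt with rfl | hj
      · rw [hT, if_neg (by simp [Fin.le_def])]
        simp
      · have hj' : i.succ ≤ j := Fin.castSucc_lt_iff_succ_le.1 hj
        obtain ⟨ih1, ih2⟩ := ih (hk.trans (Fin.castSucc_le_succ i)) hj'
        rw [hT, if_pos ⟨hk, hj'⟩]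
        have hr := Submodule.finrank_map_add_finrank_inf_ker (E.f i) (T i.succ)
        -- The case B' = ⊥: T_{i+1} modulo the kernel is isomorphic to its image.
        have hd := E.deg_le i (T i.succ) (T i.succ ⊓ LinearMap.ker (E.f i))
          ((T i.succ).map (E.f i)) ⊥ rfl (by simp)
        rw [E.deg_bot, add_zero] at hd
        have hs := h.excess_le_of_le_ker i (T i.succ ⊓ LinearMap.ker (E.f i)) inf_le_right
        have hle : finrank K ((T i.succ).map (E.f i)) ≤ finrank K (E.V j) := by omega
        refine ⟨hle, ?_⟩
        rw [excess] at hs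
        have hd' : (E.deg i.succ (T i.succ) : ℝ) ≤
          E.deg i.succ (T i.succ ⊓ LinearMap.ker (E.f i)) +
            E.deg i.castSucc ((T i.succ).map (E.f i)) := by exact_mod_cast hd
        have hr' : (finrank K ((T i.succ).map (E.f i)) : ℝ) +
          finrank K (T i.succ ⊓ LinearMap.ker (E.f i) : Submodule K _) =
            finrank K (T i.succ) := by exact_mod_cast hr
        have hle' : (finrank K ((T i.succ).map (E.f i)) : ℝ) ≤ finrank K (E.V j) := by
          exact_mod_cast hle
        have hα' := hα (Fin.castSucc_le_succ i)
        rw [← hr'] at ih2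
        nlinarith [mul_nonneg (sub_nonneg.2 hα') (sub_nonneg.2 hle')]
  have h1 := h.le T hstable
  rw [← h.top, ← sub_nonneg, ← Finset.sum_sub_distrib,
    ← Finset.sum_subset (Finset.subset_univ (Finset.Icc k j))] at h1
  · refine h1.trans (Finset.sum_le_sum fun i hi => ?_)
    obtain ⟨hki, hij⟩ := Finset.mem_Icc.1 hi
    have := (key i hki hij).2
    rw [excess, excess, finrank_top]
    nlinarith
  · intro i _ hi
    rw [hout i hi, sub_self]

/-- Semistability is tested on the family equal to the kernel of V_i → V_k at the places k ≤ i ≤ j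
and to 0 elsewhere; an induction then trades the coimages V_i / T_i for V_k. -/
theorem IsSemistable.sum_Icc_nonpos (h : E.IsSemistable α μ) (hα : Monotone α)
    (k j : Fin (r + 1)) :
    ∑ i ∈ Finset.Icc k j, ((E.deg i ⊤ : ℝ) - E.deg k ⊤ +
      (α i - μ) * ((finrank K (E.V i) : ℝ) - finrank K (E.V k))) ≤ 0 := by
  let T : ∀ i, Submodule K (E.V i) := Fin.induction ⊥
    fun i U => if k ≤ i.castSucc ∧ i.succ ≤ j then U.comap (E.f i) else ⊥
  have hT0 : T 0 = ⊥ := Fin.induction_zero ..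
  have hT : ∀ i : Fin r, T i.succ =
      if k ≤ i.castSucc ∧ i.succ ≤ j then (T i.castSucc).comap (E.f i) else ⊥ :=
    fun i => Fin.induction_succ ..
  have hstable : E.IsStable T := by
    intro i
    rw [hT]
    split_ifs
    · exact Submodule.map_comap_le _ _
    · rw [Submodule.map_bot]; exact bot_le
  have hout : ∀ i, i ∉ Finset.Icc k j → T i = ⊥ := by
    intro i hi
    rw [Finset.mem_Icc] at hi
    induction i using Fin.cases with
    | zero => exact hT0
    | succ i =>
      rw [hT, if_neg]
      rintro ⟨h1, h2⟩
      exact hi ⟨h1.trans (Fin.castSucc_le_succ i), h2⟩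
  -- Ascending induction from k, where T_k = 0 gives equality. The rank bound says that V_i / T_i
  -- embeds in V_k, and again controls the change of α.
  have key : ∀ i, k ≤ i → i ≤ j →
      (finrank K (E.V i) : ℝ) - finrank K (T i) ≤ finrank K (E.V k) ∧
      (E.deg i ⊤ : ℝ) - E.deg i (T i) - E.deg k ⊤ +
        (α i - μ) * ((finrank K (E.V i) : ℝ) - finrank K (T i) - finrank K (E.V k)) ≤ 0 := by
    intro i
    induction i using Fin.induction with
    | zero =>
      intro hk _
      obtain rfl := Fin.le_zero_iff.1 hk
      rw [hT0, E.deg_bot]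
      simp
    | succ i ih =>
      intro hk hj
      rcases hk.eq_or_lt with rfl | hk
      · rw [hT, if_neg (by simp [Fin.le_def]), E.deg_bot]
        simp
      · have hk' : k ≤ i.castSucc := Fin.le_castSucc_iff.2 hk
        obtain ⟨ih1, ih2⟩ := ih hk' ((Fin.castSucc_le_succ i).trans hj)
        rw [hT, if_pos ⟨hk', hj⟩]
        -- With P = T_i + f(V_{i+1}), the map induces V_{i+1} / T_{i+1} ≅ P / T_i. Since P contains
        -- the image, replacing V_i by P gives a stable family, which bounds the excess of P by that
        -- of V_i.
        have hr := Submodule.finrank_add_finrank_eq (E.f i) ⊤ ((T i.castSucc).comap (E.f i))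
          (T i.castSucc ⊔ (⊤ : Submodule K _).map (E.f i)) (T i.castSucc) (by simp) rfl
        have hd := E.deg_le i ⊤ ((T i.castSucc).comap (E.f i))
          (T i.castSucc ⊔ (⊤ : Submodule K _).map (E.f i)) (T i.castSucc) (by simp) rfl
        have hs := h.excess_le_of_range_le i (T i.castSucc ⊔ (⊤ : Submodule K _).map (E.f i))
          (by rw [Submodule.map_top]; exact le_sup_right)
        have hPle := Submodule.finrank_le (T i.castSucc ⊔ (⊤ : Submodule K _).map (E.f i))
        set P := T i.castSucc ⊔ (⊤ : Submodule K _).map (E.f i)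
        rw [finrank_top] at hr
        rw [excess, excess, finrank_top] at hs
        have hd' : (E.deg i.succ ⊤ : ℝ) + E.deg i.castSucc (T i.castSucc) ≤
          E.deg i.succ ((T i.castSucc).comap (E.f i)) + E.deg i.castSucc P := by
          exact_mod_cast hd
        have hr' : (finrank K (E.V i.succ) : ℝ) + finrank K (T i.castSucc) =
          finrank K ((T i.castSucc).comap (E.f i)) + finrank K P := by exact_mod_cast hr
        have hPle' : (finrank K P : ℝ) ≤ finrank K (E.V i.castSucc) := by exact_mod_cast hPle
        have hle : (finrank K (E.V i.succ) : ℝ) - finrank K ((T i.castSucc).comap (E.f i)) ≤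
          finrank K (E.V k) := by linarith
        refine ⟨hle, ?_⟩
        have hα' := hα (Fin.castSucc_le_succ i)
        have h0 : (finrank K (E.V i.succ) : ℝ) - finrank K ((T i.castSucc).comap (E.f i)) =
          finrank K P - finrank K (T i.castSucc) := by linarith
        have h2 := mul_nonneg (sub_nonneg.2 hα') (sub_nonneg.2 hle)
        rw [h0] at h2 ⊢
        nlinarith
  have h1 := h.le T hstable
  rw [← Finset.sum_subset (Finset.subset_univ (Finset.Icc k j))] at h1
  · refine (Finset.sum_le_sum fun i hi => ?_).trans h1
    obtain ⟨hki, hij⟩ := Finset.mem_Icc.1 hi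
    have := (key i hki hij).2
    rw [excess]
    nlinarith
  · intro i _ hi
    rw [hout i hi, excess_bot]

end GradedChain

/-! ### Local rings and topology of a smooth curve. -/

/-- A noetherian local domain which is the local ring of an étale algebra over a principal ideal
domain is a principal ideal domain. -/
theorem Algebra.isPrincipalIdealRing_localization_of_etale {P A B : Type u} [CommRing P]
    [IsDomain P] [IsPrincipalIdealRing P] [CommRing A] [Algebra P A] [Algebra.Etale P A] (q : Ideal A)
    [q.IsPrime] [CommRing B] [Algebra A B] [IsLocalization.AtPrime B q] [IsDomain B] :
    IsPrincipalIdealRing B := by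
  let p := q.under P
  let e : Localization.AtPrime q ≃ₐ[A] B := IsLocalization.algEquiv q.primeCompl _ _
  have : IsDomain (Localization.AtPrime q) := e.toMulEquiv.isDomain
  have : IsNoetherianRing A := Algebra.FiniteType.isNoetherianRing P A
  have : IsNoetherianRing (Localization.AtPrime q) :=
    IsLocalization.isNoetherianRing q.primeCompl _ inferInstance
  let : Algebra (Localization.AtPrime p) (Localization.AtPrime q) :=
    (Localization.localRingHom p q (algebraMap P A) (q.over_def p)).toAlgebra
  have : Localization.AtPrime.IsLiesOverAlgebra p q := ⟨rfl⟩
  -- Unramifiedness: the maximal ideal at `q` is generated by `p`, which is principal, and a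
  -- noetherian local domain with principal maximal ideal is a principal ideal domain.
  have h := ((Algebra.isUnramifiedAt_iff_map_eq P p q).1 inferInstance).2
  have hp : (IsLocalRing.maximalIdeal (Localization.AtPrime q)).IsPrincipal := by
    rw [← h]
    obtain ⟨a, ha⟩ := IsPrincipalIdealRing.principal p
    refine ⟨algebraMap P _ a, ?_⟩
    rw [ha, Ideal.submodule_span_eq, Ideal.map_span, Set.image_singleton, Ideal.submodule_span_eq]
  have : IsPrincipalIdealRing (Localization.AtPrime q) :=
    ((tfae_of_isNoetherianRing_of_isLocalRing_of_isDomain (Localization.AtPrime q)).out 4 0).1 hp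
  exact IsPrincipalIdealRing.of_surjective e.toRingHom e.surjective

namespace SmoothProjectiveCurve

variable {k : Type u} [Field k] (C : SmoothProjectiveCurve k)

/-- Locally the curve is étale over the affine line over a field, whose coordinate ring is a
principal ideal domain. -/
instance isPrincipalIdealRing_stalk (x : C.X) : IsPrincipalIdealRing (C.X.presheaf.stalk x) := by
  obtain ⟨U, -, V, hV, hx, e, hf⟩ :=
    C.smooth.exists_isStandardSmoothOfRelativeDimension x
  obtain ⟨g, -, hg⟩ := hf.exists_etale_mvPolynomial
  -- The spectrum of a field is a single point, so the nonempty open `U` is everything.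
  have hfield : IsField Γ(Spec (CommRingCat.of k), U) := by
    have hU : U = ⊤ := by
      ext y
      refine ⟨fun _ => trivial, fun _ => ?_⟩
      have : y = C.hom x := Subsingleton.elim (α := PrimeSpectrum k) _ _
      rw [this]
      exact e hx
    subst hU
    exact (Scheme.ΓSpecIso (CommRingCat.of k)).commRingCatIsoToRingEquiv.toMulEquiv.isField
      (Field.toIsField k)
  let := hfield.toField
  let E := MvPolynomial.uniqueAlgEquiv Γ(Spec (CommRingCat.of k), U) (Fin 1)
  have : IsPrincipalIdealRing (MvPolynomial (Fin 1) Γ(Spec (CommRingCat.of k), U)) :=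
    IsPrincipalIdealRing.of_surjective E.symm.toRingHom E.symm.surjective
  algebraize [g]
  let := TopCat.Presheaf.algebra_section_stalk C.X.presheaf ⟨x, hx⟩
  have := hV.isLocalization_stalk ⟨x, hx⟩
  exact Algebra.isPrincipalIdealRing_localization_of_etale
    (P := MvPolynomial (Fin 1) Γ(Spec (CommRingCat.of k), U)) (hV.primeIdealOf ⟨x, hx⟩).asIdeal

instance : IsNoetherian C.X := by
  have := C.proper
  have : CompactSpace C.X := QuasiCompact.compactSpace_of_compactSpace C.hom
  exact { }

/-- If y specializes x, then x corresponds to a prime of the local ring at y. Only the zero ideal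
and the maximal ideal are available, and they give the generic point and y. -/
theorem isClosed_of_ne_genericPoint {x : C.X} (hx : x ≠ genericPoint C.X) :
    IsClosed ({x} : Set C.X) := by
  refine isClosed_of_closure_subset fun y hy => ?_
  have hxy : x ⤳ y := specializes_iff_mem_closure.2 hy
  have hx' : x ∈ Set.range (C.X.fromSpecStalk y) := by
    rw [Scheme.range_fromSpecStalk]; exact hxy
  obtain ⟨p, rfl⟩ := hx'
  by_cases hp : p.asIdeal = ⊥
  · exfalso
    apply hx
    have hη : genericPoint C.X ∈ Set.range (C.X.fromSpecStalk y) := by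
      rw [Scheme.range_fromSpecStalk]; exact (genericPoint_spec C.X).specializes trivial
    obtain ⟨p', hp'⟩ := hη
    refine Inseparable.eq (Specializes.antisymm ?_
      ((genericPoint_spec C.X).specializes trivial))
    rw [← hp']
    refine Specializes.map ?_ (C.X.fromSpecStalk y).continuous
    exact (PrimeSpectrum.le_iff_specializes p p').1
      ((PrimeSpectrum.asIdeal_le_asIdeal p p').1 (hp ▸ bot_le))
  · have h4 := ((tfae_of_isNoetherianRing_of_isLocalRing_of_isDomain
      (C.X.presheaf.stalk y)).out 0 3).1 (C.isPrincipalIdealRing_stalk y)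
    have hp' : p = IsLocalRing.closedPoint _ := PrimeSpectrum.ext (h4.2 _ hp p.2)
    rw [hp', Scheme.fromSpecStalk_closedPoint]
    rfl

/-- The complement is a finite union of irreducible closed sets; the generic point of each differs
from that of the curve, hence is a closed point. -/
theorem finite_compl (U : C.X.Opens) (hU : genericPoint C.X ∈ U) :
    ((U : Set C.X)ᶜ).Finite := by
  obtain ⟨S, hS, hSc, hSi, h⟩ :=
    NoetherianSpace.exists_finite_set_isClosed_irreducible U.isOpen.isClosed_compl
  rw [h]
  refine hS.sUnion fun t ht => ?_
  obtain ⟨x, hx⟩ := QuasiSober.sober (hSi t ht) (hSc t ht)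
  have hxt : x ∈ t := hx.mem
  have hxη : x ≠ genericPoint C.X := by
    rintro rfl
    have : genericPoint C.X ∈ (U : Set C.X)ᶜ := h ▸ ⟨t, ht, hxt⟩
    exact this hU
  rw [← hx.def, (C.isClosed_of_ne_genericPoint hxη).closure_eq]
  exact Set.finite_singleton x

end SmoothProjectiveCurve

/-! ### Local rings as subrings of the function field. -/

namespace AlgebraicGeometry.Scheme

theorem genericPoint_mem {X : Scheme.{u}} [IrreducibleSpace X] {U : X.Opens} {x : X} (hx : x ∈ U) :
    genericPoint X ∈ U :=
  ((genericPoint_spec X).mem_open_set_iff U.isOpen).2 ⟨x, trivial, hx⟩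

theorem subsingleton_of_notMem {X : Scheme.{u}} [IrreducibleSpace X] {U : X.Opens}
    (hU : genericPoint X ∉ U) : Subsingleton Γ(X, U) := by
  have : U = ⊥ := by
    ext x
    exact ⟨fun hx => (hU (genericPoint_mem hx)).elim, fun hx => hx.elim⟩
  subst this
  infer_instance

/-- The local ring at `x` as a subring of the function field. -/
noncomputable def localSubring (X : Scheme.{u}) [IsIntegral X] (x : X) : Subring X.functionField :=
  (algebraMap (X.presheaf.stalk x) X.functionField).range

section

variable {X : Scheme.{u}} [IsIntegral X]

theorem germ_mem_localSubring {x : X} {U : X.Opens} (hx : x ∈ U) (f : Γ(X, U)) :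
    X.presheaf.germ U (genericPoint X) (genericPoint_mem hx) f ∈ X.localSubring x := by
  have : Nonempty U := ⟨⟨x, hx⟩⟩
  exact ⟨X.presheaf.germ U x hx f, algebraMap_germ_eq_germToFunctionField X hx f⟩

theorem exists_germ_eq_of_mem_localSubring {x : X} {f : X.functionField}
    (hf : f ∈ X.localSubring x) : ∃ (U : X.Opens) (hx : x ∈ U) (g : Γ(X, U)),
      X.presheaf.germ U (genericPoint X) (genericPoint_mem hx) g = f := by
  obtain ⟨f', rfl⟩ := hf
  obtain ⟨U, hx, g, rfl⟩ := X.presheaf.exists_germ_eq f'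
  have : Nonempty U := ⟨⟨x, hx⟩⟩
  exact ⟨U, hx, g, (algebraMap_germ_eq_germToFunctionField X hx g).symm⟩

/-- Finitely many elements of a local ring are defined on a common neighbourhood. -/
theorem exists_lift_of_mem_localSubring {ι : Type*} [Finite ι] {x : X} {U : X.Opens} (hx : x ∈ U)
    (f : ι → X.functionField) (hf : ∀ i, f i ∈ X.localSubring x) :
    ∃ (W : X.Opens) (_ : W ≤ U) (hW : x ∈ W) (g : ι → Γ(X, W)),
      ∀ i, X.presheaf.germ W (genericPoint X) (genericPoint_mem hW) (g i) = f i := by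
  choose V hV g hg using fun i => exists_germ_eq_of_mem_localSubring (hf i)
  have := Fintype.ofFinite ι
  let W : X.Opens := ⟨U ∩ ⋂ i, V i, U.isOpen.inter (isOpen_iInter_of_finite fun i => (V i).isOpen)⟩
  have hWV : ∀ i, W ≤ V i := fun i y hy => Set.mem_iInter.1 hy.2 i
  have hxW : x ∈ W := ⟨hx, Set.mem_iInter.2 hV⟩
  refine ⟨W, fun y hy => hy.1, hxW, fun i => X.presheaf.map (homOfLE (hWV i)).op (g i), fun i => ?_⟩
  rw [X.presheaf.germ_res_apply, hg]

instance (x : X) : IsFractionRing (X.localSubring x) X.functionField := by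
  have hinj := IsFractionRing.injective (X.presheaf.stalk x) X.functionField
  let e : X.presheaf.stalk x ≃+* X.localSubring x := RingEquiv.ofBijective
    (algebraMap (X.presheaf.stalk x) X.functionField).rangeRestrict
    ⟨fun a b h => hinj (congrArg Subtype.val h), RingHom.rangeRestrict_surjective _⟩
  refine IsFractionRing.of_ringEquiv_left e.symm fun a => ?_
  obtain ⟨b, rfl⟩ := e.surjective a
  rw [e.symm_apply_apply]
  rfl

theorem isPrincipalIdealRing_localSubring (x : X) [IsPrincipalIdealRing (X.presheaf.stalk x)] :
    IsPrincipalIdealRing (X.localSubring x) :=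
  IsPrincipalIdealRing.of_surjective
    (algebraMap (X.presheaf.stalk x) X.functionField).rangeRestrict
    (RingHom.rangeRestrict_surjective _)

theorem localSubring_genericPoint : X.localSubring (genericPoint X) = ⊤ := by
  rw [eq_top_iff]
  rintro f -
  obtain ⟨U, hU, g, rfl⟩ := X.presheaf.exists_germ_eq f
  exact germ_mem_localSubring hU g

theorem germ_genericPoint_injective {U : X.Opens} (hU : genericPoint X ∈ U) :
    Function.Injective (X.presheaf.germ U (genericPoint X) hU) :=
  germ_injective_of_isIntegral _ _ hU

end

end AlgebraicGeometry.Scheme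

namespace SmoothProjectiveCurve

variable {k : Type u} [Field k] (C : SmoothProjectiveCurve k)

/-- The local rings of a curve with their orders of vanishing. -/
noncomputable def orderSystem : OrderSystem C.X.functionField C.X where
  ring := C.X.localSubring
  isPrincipalIdealRing x := Scheme.isPrincipalIdealRing_localSubring x
  isFractionRing x := inferInstance
  ord x f := Scheme.ord f x
  ord_mul x _ _ hf hg := Scheme.ord_mul hf hg
  ord_nonneg x f hf hfx := by
    obtain ⟨U, hx, g, rfl⟩ := Scheme.exists_germ_eq_of_mem_localSubring hfx
    have : Nonempty U := ⟨⟨x, hx⟩⟩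
    have hg : g ≠ 0 := by
      rintro rfl
      exact hf (map_zero _)
    have h := Scheme.ord_le_smul hx hg 1
    have h1 : Scheme.ord (1 : C.X.functionField) x = 0 := by
      -- The order of 1 is 0 by multiplicativity, and multiplying 1 by the regular function `g`
      -- cannot lower the order.
      have := Scheme.ord_mul (x := x) (one_ne_zero (α := C.X.functionField)) one_ne_zero
      simpa using this
    rw [h1, Algebra.smul_def, mul_one] at h
    exact h
  finite_notMem f := by
    obtain ⟨U, hU, g, rfl⟩ := C.X.presheaf.exists_germ_eq f
    refine (C.finite_compl U hU).subset fun x hx hxU => hx ?_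
    exact Scheme.germ_mem_localSubring hxU g
  weight x := C.hom.residueDegree x

end SmoothProjectiveCurve

/-! ### Generic fibres of vector bundles, stalks and frames. -/

namespace AlgebraicGeometry.Scheme.Modules

section res

variable {X : Scheme.{u}} (M : X.Modules) {U W : X.Opens} (h : W ≤ U)

@[simp]
theorem res_zero : M.res h (0 : Γ(M, U)) = 0 :=
  map_zero (M.presheaf.map (homOfLE h).op).hom

theorem res_sum {ι : Type*} (I : Finset ι) (s : ι → Γ(M, U)) :
    M.res h (∑ i ∈ I, s i) = ∑ i ∈ I, M.res h (s i) :=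
  map_sum (M.presheaf.map (homOfLE h).op).hom s I

theorem res_smul (f : Γ(X, U)) (s : Γ(M, U)) :
    M.res h (f • s) = X.presheaf.map (homOfLE h).op f • M.res h s :=
  M.map_smul _ _ _

theorem res_res {W' : X.Opens} (h' : W' ≤ W) (s : Γ(M, U)) :
    M.res h' (M.res h s) = M.res (h'.trans h) s := by
  simp only [res, ← ConcreteCategory.comp_apply, ← Functor.map_comp]
  rfl

theorem app_res {N : X.Modules} (φ : M ⟶ N) (s : Γ(M, U)) :
    φ.app W (M.res h s) = N.res h (φ.app U s) :=
  congr($(φ.mapPresheaf.naturality (homOfLE h).op) s)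

theorem eq_of_locally_eq {s t : Γ(M, U)}
    (H : ∀ x ∈ U, ∃ (W : X.Opens) (_ : x ∈ W) (h : W ≤ U), M.res h s = M.res h t) : s = t := by
  choose W hW hWU hst using H
  refine TopCat.Sheaf.eq_of_locally_eq' ⟨M.presheaf, M.isSheaf⟩ (fun x : U => W x.1 x.2) U
    (fun x => homOfLE (hWU x.1 x.2)) (fun x hx => ?_) s t fun x => hst x.1 x.2
  exact Opens.mem_iSup.2 ⟨⟨x, hx⟩, hW x hx⟩

theorem IsFrame.exists_eq_sum {M : X.Modules} {n : ℕ} {s : Fin n → Γ(M, U)} (hs : M.IsFrame s)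
    (t : Γ(M, W)) : ∃ g : Fin n → Γ(X, W), t = ∑ i, g i • M.res h (s i) := by
  have : t ∈ Submodule.span Γ(X, W) (Set.range fun i => M.res h (s i)) := by
    rw [(hs W h).2]; trivial
  obtain ⟨g, hg⟩ := (Submodule.mem_span_range_iff_exists_fun _).1 this
  exact ⟨g, hg.symm⟩

end res

/-- The generic fibre of an `𝒪_X`-module, as a vector space over the function field: sections are
determined by their germs at the generic point. -/
structure GenericFibre {X : Scheme.{u}} [IsIntegral X] (M : X.Modules) (V : Type*)
    [AddCommGroup V] [Module X.functionField V] where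
  germ : ∀ U : X.Opens, genericPoint X ∈ U → Γ(M, U) →+ V
  map_smul : ∀ U hU (f : Γ(X, U)) (s : Γ(M, U)),
    germ U hU (f • s) = X.presheaf.germ U (genericPoint X) hU f • germ U hU s
  map_res : ∀ {U W : X.Opens} (h : W ≤ U) (hW : genericPoint X ∈ W) (s : Γ(M, U)),
    germ W hW (M.res h s) = germ U (h hW) s
  injective : ∀ U hU, Function.Injective (germ U hU)
  exists_eq : ∀ v, ∃ U hU s, germ U hU s = v

noncomputable instance {X : Scheme.{u}} (M : X.Modules) (x : X) :
    Module (X.presheaf.stalk x) (M.presheaf.stalk x) :=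
  PresheafOfModules.instModuleCarrierStalkCommRingCatCarrierAbPresheafOpensCarrier
    (R := X.presheaf) M.val x

theorem germ_smul {X : Scheme.{u}} (M : X.Modules) {x : X} {U : X.Opens} (hx : x ∈ U) (f : Γ(X, U))
    (s : Γ(M, U)) : M.presheaf.germ U x hx (f • s) =
      X.presheaf.germ U x hx f • M.presheaf.germ U x hx s :=
  PresheafOfModules.germ_smul (R := X.presheaf) M.val x U hx f s

/-- In a local frame the coefficients of the section vanish on a nonempty open set, hence vanish,
because the scheme is integral. -/
theorem IsVectorBundle.eq_zero_of_res_eq_zero {X : Scheme.{u}} [IsIntegral X] {M : X.Modules}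
    {n : ℕ} (hM : M.IsVectorBundle n) {U W : X.Opens} (h : W ≤ U) (hW : genericPoint X ∈ W)
    {s : Γ(M, U)} (hs : M.res h s = 0) : s = 0 := by
  refine M.eq_of_locally_eq fun x hx => ?_
  obtain ⟨V, hxV, t, ht⟩ := hM x
  refine ⟨U ⊓ V, ⟨hx, hxV⟩, inf_le_left, ?_⟩
  obtain ⟨g, hg⟩ := ht.exists_eq_sum (W := U ⊓ V) inf_le_right (M.res inf_le_left s)
  let W' := W ⊓ V
  have hW'V : genericPoint X ∈ V := genericPoint_mem hxV
  have hW' : genericPoint X ∈ W' := ⟨hW, hW'V⟩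
  have hle : W' ≤ U ⊓ V := inf_le_inf_right V h
  have h0 : M.res hle (M.res inf_le_left s) = 0 := by
    rw [res_res, ← M.res_res h (inf_le_left : W' ≤ W), hs, res_zero]
  have hg0 : ∀ i, g i = 0 := by
    intro i
    rw [hg, res_sum] at h0
    simp only [res_smul, res_res] at h0
    have := Fintype.linearIndependent_iff.1 (ht W' inf_le_right).1 _ h0 i
    have : Nonempty W' := ⟨⟨_, hW'⟩⟩
    apply map_injective_of_isIntegral X (homOfLE hle)
    rwa [map_zero]
  rw [hg, res_zero]
  simp [hg0]

/-- The stalk of a module at the generic point, as a vector space over the function field. -/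
def GenericStalk {X : Scheme.{u}} [IsIntegral X] (M : X.Modules) : Type u :=
  M.presheaf.stalk (genericPoint X)

noncomputable instance {X : Scheme.{u}} [IsIntegral X] (M : X.Modules) :
    AddCommGroup M.GenericStalk :=
  inferInstanceAs (AddCommGroup (M.presheaf.stalk (genericPoint X)))

noncomputable instance {X : Scheme.{u}} [IsIntegral X] (M : X.Modules) :
    Module X.functionField M.GenericStalk :=
  inferInstanceAs (Module (X.presheaf.stalk (genericPoint X)) (M.presheaf.stalk (genericPoint X)))

/-- The generic fibre of a vector bundle is its stalk at the generic point. -/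
noncomputable def IsVectorBundle.genericFibre {X : Scheme.{u}} [IsIntegral X] {M : X.Modules}
    {n : ℕ} (hM : M.IsVectorBundle n) : M.GenericFibre M.GenericStalk where
  germ := fun U hU => (M.presheaf.germ U (genericPoint X) hU).hom
  map_smul := fun U hU f s => M.germ_smul hU f s
  map_res := fun h hW s => M.presheaf.germ_res_apply (homOfLE h) _ hW s
  injective := fun U hU => by
    refine (injective_iff_map_eq_zero (M.presheaf.germ U (genericPoint X) hU).hom).2 fun s hs => ?_
    have hs' : M.presheaf.germ U (genericPoint X) hU s = M.presheaf.germ U (genericPoint X) hU 0 :=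
      hs.trans (map_zero (M.presheaf.germ U (genericPoint X) hU).hom).symm
    obtain ⟨W, hW, i₁, i₂, h⟩ := M.presheaf.germ_eq _ hU hU _ _ hs'
    refine hM.eq_zero_of_res_eq_zero (leOfHom i₁) hW ?_
    refine h.trans ?_
    exact map_zero (M.presheaf.map i₂.op).hom
  exists_eq := fun v => M.presheaf.exists_germ_eq v

end AlgebraicGeometry.Scheme.Modules

namespace AlgebraicGeometry.Scheme.Modules

open Module

namespace GenericFibre

variable {X : Scheme.{u}} [IsIntegral X] {M : X.Modules} {V : Type*} [AddCommGroup V]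
  [Module X.functionField V] (G : M.GenericFibre V)

/-- The germs at the generic point of the sections around `x`. -/
def stalk (x : X) : Submodule (X.localSubring x) V where
  carrier := {v | ∃ (U : X.Opens) (hx : x ∈ U) (s : Γ(M, U)), G.germ U (genericPoint_mem hx) s = v}
  zero_mem' := ⟨⊤, trivial, 0, map_zero _⟩
  add_mem' := by
    rintro _ _ ⟨U, hU, s, rfl⟩ ⟨W, hW, t, rfl⟩
    refine ⟨U ⊓ W, ⟨hU, hW⟩, M.res inf_le_left s + M.res inf_le_right t, ?_⟩
    rw [map_add, G.map_res, G.map_res]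
  smul_mem' := by
    rintro ⟨f, hf⟩ _ ⟨U, hU, s, rfl⟩
    obtain ⟨W, hWU, hW, g, hg⟩ := exists_lift_of_mem_localSubring hU (fun _ : Unit => f) fun _ => hf
    refine ⟨W, hW, g () • M.res hWU s, ?_⟩
    rw [G.map_smul, hg, G.map_res]
    rfl

theorem germ_mem_stalk {x : X} {U : X.Opens} (hx : x ∈ U) (s : Γ(M, U)) :
    G.germ U (genericPoint_mem hx) s ∈ G.stalk x := ⟨U, hx, s, rfl⟩

theorem germ_sum_smul {ι : Type*} [Fintype ι] {U : X.Opens} (hU : genericPoint X ∈ U)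
    (f : ι → Γ(X, U)) (s : ι → Γ(M, U)) : G.germ U hU (∑ i, f i • s i) =
      ∑ i, X.presheaf.germ U (genericPoint X) hU (f i) • G.germ U hU (s i) := by
  rw [map_sum]
  exact Finset.sum_congr rfl fun i _ => G.map_smul U hU _ _

theorem exists_lift {ι : Type*} [Finite ι] {x : X} {U : X.Opens} (hx : x ∈ U) (v : ι → V)
    (hv : ∀ i, v i ∈ G.stalk x) : ∃ (W : X.Opens) (_ : W ≤ U) (hW : x ∈ W) (s : ι → Γ(M, W)),
      ∀ i, G.germ W (genericPoint_mem hW) (s i) = v i := by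
  choose Y hY s hs using hv
  have := Fintype.ofFinite ι
  let W : X.Opens := ⟨U ∩ ⋂ i, Y i, U.isOpen.inter (isOpen_iInter_of_finite fun i => (Y i).isOpen)⟩
  have hWY : ∀ i, W ≤ Y i := fun i y hy => Set.mem_iInter.1 hy.2 i
  have hxW : x ∈ W := ⟨hx, Set.mem_iInter.2 hY⟩
  refine ⟨W, fun y hy => hy.1, hxW, fun i => M.res (hWY i) (s i), fun i => ?_⟩
  rw [G.map_res, hs]

variable {n : ℕ} {U : X.Opens} {s : Fin n → Γ(M, U)}

theorem linearIndependent_germ (hs : M.IsFrame s) (hU : genericPoint X ∈ U) :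
    LinearIndependent X.functionField fun i => G.germ U hU (s i) := by
  rw [Fintype.linearIndependent_iff]
  intro c hc i
  obtain ⟨W, hWU, hW, g, hg⟩ := exists_lift_of_mem_localSubring hU c
    fun i => by rw [localSubring_genericPoint]; trivial
  have h0 : ∑ i, g i • M.res hWU (s i) = 0 := by
    apply G.injective W hW
    rw [G.germ_sum_smul, map_zero, ← hc]
    refine Finset.sum_congr rfl fun i _ => ?_
    rw [hg, G.map_res]
  rw [← hg, Fintype.linearIndependent_iff.1 (hs W hWU).1 g h0 i, map_zero]

theorem exists_germ_eq_sum (hs : M.IsFrame s) {x : X} (hx : x ∈ U) {v : V} (hv : v ∈ G.stalk x) :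
    ∃ c : Fin n → X.localSubring x, v = ∑ i, c i • G.germ U (genericPoint_mem hx) (s i) := by
  obtain ⟨W, hW, t, rfl⟩ := hv
  obtain ⟨g, hg⟩ := hs.exists_eq_sum (W := W ⊓ U) inf_le_right (M.res inf_le_left t)
  have hx' : x ∈ W ⊓ U := ⟨hW, hx⟩
  refine ⟨fun i => ⟨_, germ_mem_localSubring hx' (g i)⟩, ?_⟩
  rw [← G.map_res inf_le_left (genericPoint_mem hx') t, hg, G.germ_sum_smul]
  refine Finset.sum_congr rfl fun i _ => ?_
  rw [G.map_res]
  rfl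

theorem span_germ (hs : M.IsFrame s) (hU : genericPoint X ∈ U) :
    ⊤ ≤ Submodule.span X.functionField (Set.range fun i => G.germ U hU (s i)) := by
  rintro v -
  have hv : v ∈ G.stalk (genericPoint X) := by
    obtain ⟨W, hW, t, ht⟩ := G.exists_eq v
    exact ⟨W, hW, t, ht⟩
  obtain ⟨c, rfl⟩ := G.exists_germ_eq_sum hs hU hv
  exact Submodule.sum_mem _ fun i _ => Submodule.smul_mem _ (c i : X.functionField)
    (Submodule.subset_span ⟨i, rfl⟩)

/-- The basis of the generic fibre given by a frame. -/
noncomputable def basis (hs : M.IsFrame s) (hU : genericPoint X ∈ U) :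
    Basis (Fin n) X.functionField V :=
  Basis.mk (G.linearIndependent_germ hs hU) (G.span_germ hs hU)

@[simp]
theorem basis_apply (hs : M.IsFrame s) (hU : genericPoint X ∈ U) (i : Fin n) :
    G.basis hs hU i = G.germ U hU (s i) := by
  simp [basis]

theorem span_basis (hs : M.IsFrame s) {x : X} (hx : x ∈ U) :
    Submodule.span (X.localSubring x) (Set.range (G.basis hs (genericPoint_mem hx))) =
      G.stalk x := by
  refine le_antisymm (Submodule.span_le.2 ?_) fun v hv => ?_
  · rintro _ ⟨i, rfl⟩
    rw [basis_apply]
    exact G.germ_mem_stalk hx _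
  · obtain ⟨c, rfl⟩ := G.exists_germ_eq_sum hs hx hv
    exact Submodule.sum_mem _ fun i _ => Submodule.smul_mem _ _
      (Submodule.subset_span ⟨i, by simp⟩)

/-- Independence can be checked at the generic point, where functions inject; an open set missing
that point is empty. -/
theorem isFrame_of_span {W : X.Opens} (hW : genericPoint X ∈ W) (t : Fin n → Γ(M, W))
    (hli : LinearIndependent X.functionField fun i => G.germ W hW (t i))
    (hsp : ∀ (W' : X.Opens) (h : W' ≤ W),
      Submodule.span Γ(X, W') (Set.range fun i => M.res h (t i)) = ⊤) : M.IsFrame t := by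
  refine fun W' h => ⟨?_, hsp W' h⟩
  rw [Fintype.linearIndependent_iff]
  intro c hc i
  by_cases hW' : genericPoint X ∈ W'
  · apply germ_genericPoint_injective hW'
    rw [map_zero]
    refine Fintype.linearIndependent_iff.1 hli
      (fun i => X.presheaf.germ W' (genericPoint X) hW' (c i)) ?_ i
    rw [← map_zero (G.germ W' hW'), ← hc, G.germ_sum_smul]
    refine Finset.sum_congr rfl fun i _ => ?_
    rw [G.map_res]
  · have := subsingleton_of_notMem hW'
    exact Subsingleton.elim _ _

/-- Every basis of the stalk at `x` extends to a frame around `x`. -/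
theorem exists_isFrame (hs : M.IsFrame s) {x : X} (hx : x ∈ U) (b : Basis (Fin n) X.functionField V)
    (hb : Submodule.span (X.localSubring x) (Set.range b) = G.stalk x) :
    ∃ (W : X.Opens) (hW : x ∈ W) (t : Fin n → Γ(M, W)), M.IsFrame t ∧
      ∀ i, G.germ W (genericPoint_mem hW) (t i) = b i := by
  obtain ⟨W₁, hW₁U, hW₁, t, ht⟩ := G.exists_lift hx b fun i => by
    rw [← hb]; exact Submodule.subset_span ⟨i, rfl⟩
  have hsb : ∀ i, ∃ c : Fin n → X.localSubring x,
      G.germ U (genericPoint_mem hx) (s i) = ∑ j, c j • b j := fun i => by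
    have := G.germ_mem_stalk hx (s i)
    rw [← hb, Submodule.mem_span_range_iff_exists_fun] at this
    obtain ⟨c, hc⟩ := this
    exact ⟨c, hc.symm⟩
  -- The old frame has coefficients in the local ring with respect to `b`. On a neighbourhood where
  -- these are regular, the lifts of `b` span the old frame and therefore everything.
  choose c hc using hsb
  obtain ⟨W, hWW₁, hW, g, hg⟩ := exists_lift_of_mem_localSubring hW₁
    (fun p : Fin n × Fin n => (c p.1 p.2 : X.functionField)) fun p => (c p.1 p.2).2
  have ht' : ∀ i, G.germ W (genericPoint_mem hW) (M.res hWW₁ (t i)) = b i := fun i => by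
    rw [G.map_res, ht]
  have hst : ∀ i, M.res (hWW₁.trans hW₁U) (s i) = ∑ j, g (i, j) • M.res hWW₁ (t j) := fun i => by
    apply G.injective W (genericPoint_mem hW)
    rw [G.map_res, hc, G.germ_sum_smul]
    refine Finset.sum_congr rfl fun j _ => ?_
    rw [hg, ht']
    rfl
  refine ⟨W, hW, fun i => M.res hWW₁ (t i), ?_, ht'⟩
  refine G.isFrame_of_span (genericPoint_mem hW) _ ?_ fun W' h => ?_
  · convert b.linearIndependent with i
    exact ht' i
  · rw [eq_top_iff, ← (hs W' (h.trans (hWW₁.trans hW₁U))).2, Submodule.span_le]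
    rintro _ ⟨i, rfl⟩
    dsimp only
    rw [SetLike.mem_coe, ← M.res_res (hWW₁.trans hW₁U) h, hst, res_sum]
    refine Submodule.sum_mem _ fun j _ => ?_
    rw [res_smul]
    exact Submodule.smul_mem _ _ (Submodule.subset_span ⟨j, rfl⟩)

theorem exists_basis (G : M.GenericFibre V) (hM : M.IsVectorBundle n) :
    Nonempty (Basis (Fin n) X.functionField V) := by
  obtain ⟨U, hU, s, hs⟩ := hM (genericPoint X)
  exact ⟨G.basis hs hU⟩

theorem finite (G : M.GenericFibre V) (hM : M.IsVectorBundle n) :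
    Module.Finite X.functionField V := by
  obtain ⟨b⟩ := G.exists_basis hM
  exact Module.Finite.of_basis b

theorem finrank_eq (G : M.GenericFibre V) (hM : M.IsVectorBundle n) :
    finrank X.functionField V = n := by
  obtain ⟨b⟩ := G.exists_basis hM
  simpa using finrank_eq_card_basis b

theorem exists_isFrame_genericPoint (hM : M.IsVectorBundle n)
    (b : Basis (Fin n) X.functionField V) :
    ∃ (W : X.Opens) (hW : genericPoint X ∈ W) (t : Fin n → Γ(M, W)), M.IsFrame t ∧
      ∀ i, G.germ W hW (t i) = b i := by
  obtain ⟨U, hU, s, hs⟩ := hM (genericPoint X)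
  refine G.exists_isFrame hs hU b ?_
  have h : ∀ v : V, v ∈ Submodule.span (X.localSubring (genericPoint X)) (Set.range b) := by
    intro v
    rw [← b.sum_repr v]
    refine Submodule.sum_mem _ fun i _ => ?_
    exact Submodule.smul_mem _
      (⟨b.repr v i, by rw [localSubring_genericPoint]; trivial⟩ :
        X.localSubring (genericPoint X)) (Submodule.subset_span ⟨i, rfl⟩)
  refine le_antisymm (fun v _ => ?_) fun v _ => h v
  obtain ⟨W, hW, t, ht⟩ := G.exists_eq v
  exact ⟨W, hW, t, ht⟩

/-- The linear map induced on generic fibres by a morphism. -/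
theorem exists_linearMap {N : X.Modules} {W : Type*} [AddCommGroup W] [Module X.functionField W]
    (H : N.GenericFibre W) (φ : M ⟶ N) : ∃ f : V →ₗ[X.functionField] W,
      ∀ U hU s, f (G.germ U hU s) = H.germ U hU (φ.app U s) := by
  choose Y hY t ht using G.exists_eq
  -- The value at `v` does not depend on the section chosen to represent `v`; linearity follows by
  -- choosing convenient sections.
  have key : ∀ U hU s v, G.germ U hU s = v →
      H.germ (Y v) (hY v) (φ.app (Y v) (t v)) = H.germ U hU (φ.app U s) := by
    intro U hU s v hv
    have hW : genericPoint X ∈ U ⊓ Y v := ⟨hU, hY v⟩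
    have : M.res (inf_le_left : U ⊓ Y v ≤ U) s = M.res inf_le_right (t v) := by
      apply G.injective _ hW
      rw [G.map_res, G.map_res, hv, ht]
    rw [← H.map_res (inf_le_right : U ⊓ Y v ≤ Y v) hW, ← H.map_res (inf_le_left : U ⊓ Y v ≤ U) hW,
      ← app_res, ← app_res, this]
  refine ⟨⟨⟨fun v => H.germ (Y v) (hY v) (φ.app (Y v) (t v)), fun v w => ?_⟩, fun c v => ?_⟩,
    fun U hU s => key U hU s _ rfl⟩
  · have hW : genericPoint X ∈ Y v ⊓ Y w := ⟨hY v, hY w⟩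
    rw [key (Y v ⊓ Y w) hW (M.res inf_le_left (t v) + M.res inf_le_right (t w)) (v + w)
      (by rw [map_add, G.map_res, G.map_res, ht, ht]), map_add, map_add, app_res, app_res,
      H.map_res, H.map_res]
  · obtain ⟨W, hWU, hW, g, hg⟩ := exists_lift_of_mem_localSubring (hY v) (fun _ : Unit => c)
      fun _ => by rw [localSubring_genericPoint]; trivial
    dsimp only [RingHom.id_apply]
    rw [key W hW (g () • M.res hWU (t v)) (c • v) (by rw [G.map_smul, hg, G.map_res, ht]),
      Hom.app_smul, H.map_smul, hg, app_res, H.map_res]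

theorem map_mem_stalk {N : X.Modules} {W : Type*} [AddCommGroup W] [Module X.functionField W]
    (H : N.GenericFibre W) (φ : M ⟶ N) (f : V →ₗ[X.functionField] W)
    (hf : ∀ U hU s, f (G.germ U hU s) = H.germ U hU (φ.app U s)) {x : X} {v : V}
    (hv : v ∈ G.stalk x) : f v ∈ H.stalk x := by
  obtain ⟨U, hU, s, rfl⟩ := hv
  rw [hf]
  exact H.germ_mem_stalk hU _

/-! ### Saturated subsheaves attached to subspaces of the generic fibre. -/

/-- The sections of `M` whose germ at the generic point lies in a subspace `T`. -/
noncomputable def saturationSubmodule (T : Submodule X.functionField V) :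
    PresheafOfModules.Submodule M.val where
  obj U :=
    { carrier := {s : Γ(M, U.unop) | ∀ hU, G.germ U.unop hU s ∈ T}
      zero_mem' := fun hU => by
        have := map_zero (G.germ U.unop hU)
        exact this.symm ▸ zero_mem T
      add_mem' := fun {s t} hs ht hU => by
        have := map_add (G.germ U.unop hU) s t
        exact this.symm ▸ add_mem (hs hU) (ht hU)
      smul_mem' := fun f s hs hU => by
        have := G.map_smul U.unop hU f s
        exact this.symm ▸ T.smul_mem _ (hs hU) }
  map {U W} i s hs hW := by
    have := G.map_res (leOfHom i.unop) hW s
    exact this.symm ▸ hs _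

/-- The condition on germs is local: if the union of a cover contains the generic point, so does one
of its members, and the germ may be computed there. -/
theorem isSheaf_saturation (T : Submodule X.functionField V) :
    TopCat.Presheaf.IsSheaf (X := X.toTopCat)
      ((G.saturationSubmodule T).toPresheafOfModules.presheaf) := by
  rw [TopCat.Presheaf.isSheaf_iff_isSheafUniqueGluing]
  intro ι U sf hsf
  obtain ⟨s, hs, huniq⟩ := TopCat.Presheaf.IsSheaf.isSheafUniqueGluing (F := M.presheaf) M.isSheaf U
    (fun i => (sf i).1) fun i j => congrArg Subtype.val (hsf i j)
  refine ⟨⟨s, fun hU => ?_⟩, fun i => Subtype.ext (hs i), fun t ht => Subtype.ext ?_⟩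
  · obtain ⟨i, hi⟩ := Opens.mem_iSup.1 hU
    have h1 := G.map_res (le_iSup U i) hi s
    have h2 : M.res (le_iSup U i) s = (sf i).1 := hs i
    rw [← h1, h2]
    exact (sf i).2 hi
  · exact huniq t.1 fun i => congrArg Subtype.val (ht i)

/-- The saturated subsheaf of `M` with generic fibre `T`. -/
theorem exists_saturation (T : Submodule X.functionField V) :
    ∃ (N : X.Modules) (ι : N ⟶ M), Mono ι ∧ (∀ U, Function.Injective (ι.app U)) ∧
      (∀ U s, (∃ t, ι.app U t = s) ↔ ∀ hU, G.germ U hU s ∈ T) ∧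
      ∀ (P : X.Modules) (g : P ⟶ M), (∀ U hU s, G.germ U hU (g.app U s) ∈ T) →
        ∃ g' : P ⟶ N, g' ≫ ι = g := by
  let N : X.Modules := ⟨(G.saturationSubmodule T).toPresheafOfModules, G.isSheaf_saturation T⟩
  let ι : N ⟶ M := ⟨(G.saturationSubmodule T).ι⟩
  have hinj : ∀ U, Function.Injective (ι.app U) := fun U s t h => Subtype.ext h
  refine ⟨N, ι, ⟨fun a b h => ?_⟩, hinj, fun U s => ⟨?_, fun h => ⟨⟨s, h⟩, rfl⟩⟩, fun P g hg => ?_⟩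
  · refine hom_ext _ _ fun U => ?_
    ext x
    apply hinj
    exact congr(($h).app U x)
  · rintro ⟨t, rfl⟩
    exact t.2
  · refine ⟨⟨⟨fun U => ModuleCat.ofHom ((g.val.app U).hom.codRestrict _ fun s hU => hg U.unop hU s),
      ?_⟩⟩, rfl⟩
    intro U W i
    ext s
    apply Subtype.ext
    exact congr($(g.val.naturality i) s)

end GenericFibre

end AlgebraicGeometry.Scheme.Modules

namespace AlgebraicGeometry.Scheme.Modules.GenericFibre

open Module

variable {X : Scheme.{u}} [IsIntegral X] {M N : X.Modules} {V : Type*} [AddCommGroup V]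
  [Module X.functionField V] (G : M.GenericFibre V)

/-- The image of `ι` is the saturated subsheaf of `M` with generic fibre `T`. -/
structure IsSaturation (T : Submodule X.functionField V) (ι : N ⟶ M) : Prop where
  mono : Mono ι
  injective : ∀ U, Function.Injective (ι.app U)
  exists_iff : ∀ U s, (∃ t, ι.app U t = s) ↔ ∀ hU, G.germ U hU s ∈ T
  lift : ∀ (P : X.Modules) (g : P ⟶ M), (∀ U hU s, G.germ U hU (g.app U s) ∈ T) →
    ∃ g' : P ⟶ N, g' ≫ ι = g

namespace IsSaturation

variable {G} {T : Submodule X.functionField V} {ι : N ⟶ M} (h : G.IsSaturation T ι)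

include h

theorem germ_mem {U : X.Opens} (hU : genericPoint X ∈ U) (t : Γ(N, U)) :
    G.germ U hU (ι.app U t) ∈ T := (h.exists_iff U _).1 ⟨t, rfl⟩ hU

/-- The generic fibre of the saturated subsheaf is the given subspace. -/
noncomputable def genericFibre : N.GenericFibre T where
  germ U hU :=
    { toFun t := ⟨G.germ U hU (ι.app U t), h.germ_mem hU t⟩
      map_zero' := Subtype.ext (by simp)
      map_add' s t := Subtype.ext (by simp) }
  map_smul U hU f s := Subtype.ext (by simp [G.map_smul])
  map_res hWU hW s := Subtype.ext (by simp [app_res, G.map_res])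
  injective U hU s t hst := h.injective U (G.injective U hU (congrArg Subtype.val hst))
  exists_eq := by
    rintro ⟨v, hv⟩
    obtain ⟨U, hU, s, rfl⟩ := G.exists_eq v
    obtain ⟨t, rfl⟩ := (h.exists_iff U s).2 fun _ => hv
    exact ⟨U, hU, t, rfl⟩

theorem stalk_genericFibre (x : X) : h.genericFibre.stalk x =
    (G.stalk x).comap (T.subtype.restrictScalars (X.localSubring x)) := by
  ext v
  constructor
  · rintro ⟨U, hx, s, rfl⟩
    exact G.germ_mem_stalk hx _
  · rintro ⟨U, hx, s, hs⟩
    obtain ⟨t, rfl⟩ := (h.exists_iff U s).2 fun _ => hs ▸ v.2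
    exact ⟨U, hx, t, Subtype.ext hs⟩

/-- A frame of `M` whose first sections lie in `T`, while the other ones are independent modulo
`T`, induces a frame of the saturated subsheaf. -/
theorem exists_isFrame_of_adapted {m l : ℕ} {W : X.Opens} (hW : genericPoint X ∈ W)
    {t : Fin (m + l) → Γ(M, W)} (ht : M.IsFrame t)
    (hT : ∀ i, G.germ W hW (t (Fin.castAdd l i)) ∈ T)
    (hli : LinearIndependent X.functionField
      fun i => T.mkQ (G.germ W hW (t (Fin.natAdd m i)))) :
    ∃ u : Fin m → Γ(N, W), N.IsFrame u := by
  choose u hu using fun i => (h.exists_iff W (t (Fin.castAdd l i))).2 fun _ => hT i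
  refine ⟨u, h.genericFibre.isFrame_of_span hW u ?_ fun W' hW' => ?_⟩
  · refine LinearIndependent.of_comp T.subtype ?_
    convert (G.linearIndependent_germ ht hW).comp (Fin.castAdd l) (Fin.castAdd_injective _ _)
      using 2
    funext i
    exact congrArg (G.germ W hW) (hu i)
  by_cases hη : genericPoint X ∈ W'
  · rw [eq_top_iff]
    rintro s -
    obtain ⟨g, hg⟩ := ht.exists_eq_sum hW' (ι.app W' s)
    -- Modulo `T` only the last sections survive, and they are independent there.
    have h0 : ∀ i, g (Fin.natAdd m i) = 0 := fun i => by
      apply germ_genericPoint_injective hη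
      rw [map_zero]
      refine Fintype.linearIndependent_iff.1 hli
        (fun i => X.presheaf.germ W' (genericPoint X) hη (g (Fin.natAdd m i))) ?_ i
      have h1 : T.mkQ (G.germ W' hη (ι.app W' s)) = 0 :=
        (Submodule.Quotient.mk_eq_zero _).2 (h.germ_mem hη s)
      rw [hg, G.germ_sum_smul, Fin.sum_univ_add, map_add, map_sum, map_sum,
        Finset.sum_eq_zero, zero_add] at h1
      · rw [← h1]
        refine Finset.sum_congr rfl fun i _ => ?_
        rw [LinearMap.map_smul, G.map_res]
      · intro i _
        rw [LinearMap.map_smul, G.map_res]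
        have : T.mkQ (G.germ W (hW' hη) (t (Fin.castAdd l i))) = 0 :=
          (Submodule.Quotient.mk_eq_zero _).2 (hT i)
        rw [this, smul_zero]
    have : s = ∑ i, g (Fin.castAdd l i) • N.res hW' (u i) := by
      apply h.injective W'
      rw [hg, Fin.sum_univ_add]
      simp [h0, app_res, hu]
    rw [this]
    exact Submodule.sum_mem _ fun i _ => Submodule.smul_mem _ _ (Submodule.subset_span ⟨i, rfl⟩)
  · have := subsingleton_of_notMem hη
    have := Module.subsingleton Γ(X, W') Γ(N, W')
    exact Subsingleton.elim _ _

end IsSaturation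

end AlgebraicGeometry.Scheme.Modules.GenericFibre

/-! ### Degrees of vector bundles through lattices. -/

namespace SmoothProjectiveCurve

open Module AlgebraicGeometry.Scheme AlgebraicGeometry.Scheme.Modules

variable {k : Type u} [Field k] {C : SmoothProjectiveCurve k} {M N : C.X.Modules} {n : ℕ}
  {V : Type*} [AddCommGroup V] [Module C.X.functionField V] (G : M.GenericFibre V)

/-- A frame on a neighbourhood of the generic point spans the stalk at each of its points, and only
finitely many points are left out. -/
theorem isLatticeFamily_stalk [Module.Finite C.X.functionField V] (hM : M.IsVectorBundle n) :
    C.orderSystem.IsLatticeFamily G.stalk where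
  isLattice x := by
    obtain ⟨U, hx, s, hs⟩ := hM x
    have hb : Submodule.span (C.orderSystem.ring x)
      (Set.range (G.basis hs (genericPoint_mem hx))) = G.stalk x := G.span_basis hs hx
    rw [← hb]
    refine ⟨Submodule.fg_span (Set.finite_range _), ?_⟩
    rw [eq_top_iff, ← (G.basis hs (genericPoint_mem hx)).span_eq]
    exact Submodule.span_mono Submodule.subset_span
  finite := by
    obtain rfl := G.finrank_eq hM
    obtain ⟨U, hU, s, hs⟩ := hM (genericPoint C.X)
    refine ⟨G.basis hs hU, (C.finite_compl U hU).subset fun x hx hxU => hx ?_⟩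
    exact (G.span_basis hs hxU).symm

/-- The degree of a vector bundle computed by any basis of its generic fibre. -/
theorem hasDegree_order (hM : M.IsVectorBundle n) (a : Basis (Fin n) C.X.functionField V) :
    C.HasDegree M n (∑ᶠ x, C.orderSystem.order x (G.stalk x) a * (C.orderSystem.weight x : ℤ)) := by
  obtain ⟨U, hU, s, hs, hsa⟩ := G.exists_isFrame_genericPoint hM a
  refine ⟨U, hU, s, _, hs, fun x => ?_, rfl⟩
  obtain ⟨Y, hx, t, ht⟩ := hM x
  have hY := genericPoint_mem hx
  have hW : genericPoint C.X ∈ U ⊓ Y := ⟨hU, hY⟩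
  choose g hg using fun i => ht.exists_eq_sum (W := U ⊓ Y) inf_le_right (M.res inf_le_left (s i))
  refine ⟨Y, hx, t, U ⊓ Y, inf_le_left, inf_le_right, hW, Matrix.of g, ht, hg, ?_⟩
  rw [C.orderSystem.order_eq a (G.basis ht hY) (G.span_basis ht hx)]
  change Scheme.ord _ x = _
  congr 1
  -- `HasOrderAt` records the coefficients in rows, `Basis.toMatrix` in columns.
  rw [Basis.det_apply, ← Matrix.det_transpose, RingHom.map_det]
  congr 1
  ext i j
  have h1 : a i = ∑ j, C.X.presheaf.germ (U ⊓ Y) (genericPoint C.X) hW (g i j) •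
      G.basis ht hY j := by
    rw [← hsa, ← G.map_res inf_le_left hW, hg, G.germ_sum_smul]
    refine Finset.sum_congr rfl fun j _ => ?_
    rw [G.map_res, G.basis_apply]
  simp only [Matrix.transpose_apply, Basis.toMatrix_apply, RingHom.mapMatrix_apply,
    Matrix.map_apply, Matrix.of_apply]
  rw [h1, Basis.repr_sum_self]

variable {G}

/-- A basis of the stalk of M at x adapted to `T` extends to a frame of M around x, whose first part
is a frame of the saturation. -/
theorem isVectorBundle_saturation {T : Submodule C.X.functionField V} {ι : N ⟶ M}
    (h : G.IsSaturation T ι) (hM : M.IsVectorBundle n) :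
    N.IsVectorBundle (finrank C.X.functionField T) := by
  intro x
  have := G.finite hM
  have := (isLatticeFamily_stalk G hM).isLattice x
  obtain ⟨b, c, e, hb, hc, he, -, -⟩ := C.orderSystem.exists_adapted_basis (x := x) (G.stalk x)
    T.subtype_injective (j := T.subtype) (p := T.mkQ) (by simp) T.mkQ_surjective
    (finBasis _ T) (finBasis _ (V ⧸ T))
  -- The rank of M is rewritten as dim T + dim V/T, to match the index type of the adapted frame.
  obtain rfl := (G.finrank_eq hM).symm.trans
    (finrank_eq_card_basis (e.reindex finSumFinEquiv)) |>.trans (Fintype.card_fin _)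
  obtain ⟨U, hU, s, hs⟩ := hM x
  obtain ⟨W, hW, t, ht, hte⟩ := G.exists_isFrame hs hU (e.reindex finSumFinEquiv)
    (by rw [Basis.range_reindex]; exact he)
  have ht1 : ∀ i, G.germ W (genericPoint_mem hW) (t (Fin.castAdd _ i)) = b i := fun i => by
    rw [hte]; simp [hb]
  have ht2 : ∀ i, T.mkQ (G.germ W (genericPoint_mem hW) (t (Fin.natAdd _ i))) = c i := fun i => by
    rw [hte]; simpa using hc i
  obtain ⟨u, hu⟩ := h.exists_isFrame_of_adapted (genericPoint_mem hW) ht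
    (fun i => by rw [ht1]; exact (b i).2) (by simp only [ht2]; exact c.linearIndependent)
  exact ⟨W, hW, u, hu⟩

end SmoothProjectiveCurve

namespace OrderSystem

open Module

variable {K X : Type*} [Field K] {S : OrderSystem K X} {V : Type*} [AddCommGroup V] [Module K V]
  [Module.Finite K V]

theorem deg_eq_zero_of_subsingleton [Subsingleton V] (L : ∀ x, Submodule (S.ring x) V) :
    S.deg L = 0 := by
  refine (finsum_congr fun x => ?_).trans finsum_zero
  have : L x = Submodule.span (S.ring x) (Set.range (finBasis K V)) := Subsingleton.elim _ _
  rw [this, order_span, zero_mul]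

theorem IsLatticeFamily.deg_sub_top (hS : S.PrincipalDegreeZero)
    {L : ∀ x, Submodule (S.ring x) V} (hL : S.IsLatticeFamily L) :
    S.deg (OrderSystem.sub L ⊤) = S.deg L := by
  have h := hL.deg_exact hS (j := (⊤ : Submodule K V).subtype) (p := (⊤ : Submodule K V).mkQ)
    (Submodule.subtype_injective _) (by simp) (Submodule.mkQ_surjective _)
  have : Subsingleton (V ⧸ (⊤ : Submodule K V)) := Submodule.Quotient.subsingleton_iff.2 rfl
  rw [h, deg_eq_zero_of_subsingleton fun x => (L x).map _, add_zero]
  rfl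

end OrderSystem

/-! ### Slopes, and the passage from chains of bundles to chains of vector spaces. -/

theorem Finset.sum_sub_mul {ι : Type*} (s : Finset ι) (α x y : ι → ℝ) (μ : ℝ) :
    ∑ i ∈ s, (x i + (α i - μ) * y i) = ∑ i ∈ s, (x i + α i * y i) - μ * ∑ i ∈ s, y i := by
  rw [Finset.mul_sum, ← Finset.sum_sub_distrib]
  exact Finset.sum_congr rfl fun i _ => by ring

theorem Finset.sum_div_sum_le_iff {ι : Type*} {s : Finset ι} {α x y : ι → ℝ} {μ : ℝ}
    (h : 0 < ∑ i ∈ s, y i) : (∑ i ∈ s, (x i + α i * y i)) / ∑ i ∈ s, y i ≤ μ ↔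
      ∑ i ∈ s, (x i + (α i - μ) * y i) ≤ 0 := by
  rw [div_le_iff₀ h, Finset.sum_sub_mul, sub_nonpos]

theorem Finset.le_sum_div_sum_iff {ι : Type*} {s : Finset ι} {α x y : ι → ℝ} {μ : ℝ}
    (h : 0 < ∑ i ∈ s, y i) : μ ≤ (∑ i ∈ s, (x i + α i * y i)) / ∑ i ∈ s, y i ↔
      0 ≤ ∑ i ∈ s, (x i + (α i - μ) * y i) := by
  rw [le_div_iff₀ h, Finset.sum_sub_mul, sub_nonneg]

theorem sum_natCast_pos {r : ℕ} {n : Fin (r + 1) → ℕ} (hn : n ≠ 0) : 0 < ∑ i, (n i : ℝ) := by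
  obtain ⟨i, hi⟩ := Function.ne_iff.1 hn
  exact Finset.sum_pos' (fun i _ => Nat.cast_nonneg _)
    ⟨i, Finset.mem_univ i, Nat.cast_pos.2 (Nat.pos_of_ne_zero hi)⟩

theorem sum_add_mul_chainSlope {r : ℕ} {α : Fin (r + 1) → ℝ} {n : Fin (r + 1) → ℕ}
    {d : Fin (r + 1) → ℤ} (hn : n ≠ 0) :
    ∑ i, ((d i : ℝ) + (α i - chainSlope α n d) * n i) = 0 := by
  rw [Finset.sum_sub_mul, chainSlope, div_mul_cancel₀ _ (sum_natCast_pos hn).ne', sub_self]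

namespace SmoothProjectiveCurve.Chain

open Module AlgebraicGeometry.Scheme AlgebraicGeometry.Scheme.Modules

variable {k : Type u} [Field k] {C : SmoothProjectiveCurve k} {r : ℕ} {E : C.Chain r}
  {α : Fin (r + 1) → ℝ} {d : Fin (r + 1) → ℤ}

/-- The degrees of the bundles of a semistable chain are well defined. -/
theorem IsSemistable.hasDegree_unique (hE : E.IsSemistable α) (h0 : E.rank ≠ 0)
    (hd : E.HasDegree d) {i : Fin (r + 1)} {a b : ℤ} (ha : C.HasDegree (E.obj i) (E.rank i) a)
    (hb : C.HasDegree (E.obj i) (E.rank i) b) : a = b := by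
  have hu : ∀ a, C.HasDegree (E.obj i) (E.rank i) a → E.HasDegree (Function.update d i a) := by
    intro a ha j
    obtain rfl | hj := eq_or_ne j i
    · rwa [Function.update_self]
    · rw [Function.update_of_ne hj]
      exact hd j
  have hsub : E.IsSubchain E := ⟨fun i => 𝟙 _, fun i => inferInstance, fun i => by simp⟩
  have key : ∀ a b, C.HasDegree (E.obj i) (E.rank i) a → C.HasDegree (E.obj i) (E.rank i) b →
      b ≤ a := by
    intro a b ha hb
    -- E is compared with itself, with `b` on the subchain side and `a` on the other; all remaining
    -- terms cancel.
    have h1 := (Finset.sum_div_sum_le_iff (sum_natCast_pos h0)).1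
      (hE E _ _ (hu a ha) (hu b hb) hsub h0)
    rw [← sum_add_mul_chainSlope (α := α) (d := Function.update d i a) h0, ← sub_nonpos,
      ← Finset.sum_sub_distrib, Finset.sum_eq_single i] at h1
    · simp only [Function.update_self] at h1
      have : (b : ℝ) ≤ a := by linarith
      exact_mod_cast this
    · intro j _ hj
      simp [Function.update_of_ne hj]
    · simp
  exact le_antisymm (key b a hb ha) (key a b ha hb)

/-- The existence of a nonzero semistable chain implies that principal divisors have degree zero,
as otherwise its degrees could be chosen arbitrarily. -/
theorem IsSemistable.principalDegreeZero (hE : E.IsSemistable α) (h0 : E.rank ≠ 0)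
    (hd : E.HasDegree d) : C.orderSystem.PrincipalDegreeZero := by
  intro f hf
  obtain ⟨i, hi⟩ := Function.ne_iff.1 h0
  let G := (E.isVectorBundle i).genericFibre
  have := G.finite (E.isVectorBundle i)
  obtain ⟨a⟩ := G.exists_basis (E.isVectorBundle i)
  have := Fin.pos_iff_nonempty.1 (Nat.pos_of_ne_zero hi)
  let j₀ := Classical.arbitrary (Fin (E.rank i))
  -- Scaling one basis vector by `f` makes the transition determinant equal to `f`, so the two
  -- degrees differ by the degree of the divisor of `f`.
  let a' := a.unitsSMul (Function.update 1 j₀ (Units.mk0 f hf))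
  have hdet : a.det a' = f := by
    rw [Basis.det_unitsSMul_self, Finset.prod_eq_single j₀]
    · simp
    · intro j _ hj
      simp [Function.update_of_ne hj]
    · simp
  have h := (isLatticeFamily_stalk G (E.isVectorBundle i)).finsum_order_change a a'
  rw [hE.hasDegree_unique h0 hd (hasDegree_order G (E.isVectorBundle i) a')
    (hasDegree_order G (E.isVectorBundle i) a), hdet] at h
  simpa using h

variable (E)

/-- The generic fibre of a chain, with the degrees of saturated subsheaves. -/
noncomputable def gradedChain (hS : C.orderSystem.PrincipalDegreeZero) :
    GradedChain C.X.functionField r where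
  V i := (E.obj i).GenericStalk
  addCommGroup i := inferInstance
  module i := inferInstance
  finite i := (E.isVectorBundle i).genericFibre.finite (E.isVectorBundle i)
  f i := ((E.isVectorBundle i.succ).genericFibre.exists_linearMap
    (E.isVectorBundle i.castSucc).genericFibre (E.map i)).choose
  deg i T :=
    have := (E.isVectorBundle i).genericFibre.finite (E.isVectorBundle i)
    C.orderSystem.deg (OrderSystem.sub (E.isVectorBundle i).genericFibre.stalk T)
  deg_bot i :=
    have := (E.isVectorBundle i).genericFibre.finite (E.isVectorBundle i)
    OrderSystem.deg_eq_zero_of_subsingleton _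
  deg_le i A A' B B' hA hB := by
    have := (E.isVectorBundle i.succ).genericFibre.finite (E.isVectorBundle i.succ)
    have := (E.isVectorBundle i.castSucc).genericFibre.finite (E.isVectorBundle i.castSucc)
    exact (isLatticeFamily_stalk _ (E.isVectorBundle i.succ)).deg_sub_add_deg_sub_le hS
      (isLatticeFamily_stalk _ (E.isVectorBundle i.castSucc)) _
      (fun x v hv => GenericFibre.map_mem_stalk _ _ (E.map i) _
        ((E.isVectorBundle i.succ).genericFibre.exists_linearMap
          (E.isVectorBundle i.castSucc).genericFibre (E.map i)).choose_spec hv) A A' B B' hA hB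

variable {E}

theorem gradedChain_f_germ (hS : C.orderSystem.PrincipalDegreeZero) (i : Fin r) (U : C.X.Opens)
    (hU : genericPoint C.X ∈ U) (s : Γ(E.obj i.succ, U)) :
    (E.gradedChain hS).f i ((E.isVectorBundle i.succ).genericFibre.germ U hU s) =
      (E.isVectorBundle i.castSucc).genericFibre.germ U hU ((E.map i).app U s) :=
  ((E.isVectorBundle i.succ).genericFibre.exists_linearMap
    (E.isVectorBundle i.castSucc).genericFibre (E.map i)).choose_spec U hU s

theorem finrank_gradedChain (hS : C.orderSystem.PrincipalDegreeZero) (i : Fin (r + 1)) :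
    finrank C.X.functionField ((E.gradedChain hS).V i) = E.rank i :=
  (E.isVectorBundle i).genericFibre.finrank_eq (E.isVectorBundle i)

theorem IsSemistable.deg_gradedChain_top (hE : E.IsSemistable α) (h0 : E.rank ≠ 0)
    (hd : E.HasDegree d) (hS : C.orderSystem.PrincipalDegreeZero) (i : Fin (r + 1)) :
    (E.gradedChain hS).deg i ⊤ = d i := by
  let G := (E.isVectorBundle i).genericFibre
  have := G.finite (E.isVectorBundle i)
  obtain ⟨a⟩ := G.exists_basis (E.isVectorBundle i)
  refine hE.hasDegree_unique h0 hd (i := i) ?_ (hd i)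
  have hL := isLatticeFamily_stalk G (E.isVectorBundle i)
  have h : (E.gradedChain hS).deg i ⊤ = ∑ᶠ x, C.orderSystem.order x (G.stalk x) a *
    (C.orderSystem.weight x : ℤ) := (hL.deg_sub_top hS).trans (hL.deg_eq hS a)
  rw [h]
  exact hasDegree_order G (E.isVectorBundle i) a

/-- A stable family of subspaces of the generic fibre comes from a subchain. -/
theorem exists_subchain (hS : C.orderSystem.PrincipalDegreeZero)
    (T : ∀ i, Submodule C.X.functionField (E.obj i).GenericStalk)
    (hT : (E.gradedChain hS).IsStable T) : ∃ F : C.Chain r, F.IsSubchain E ∧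
      F.rank = (fun i => finrank C.X.functionField (T i)) ∧
      F.HasDegree fun i => (E.gradedChain hS).deg i (T i) := by
  let G := fun i => (E.isVectorBundle i).genericFibre
  choose N ι h₁ h₂ h₃ h₄ using fun i => (G i).exists_saturation (T i)
  have h : ∀ i, (G i).IsSaturation (T i) (ι i) := fun i => ⟨h₁ i, h₂ i, h₃ i, h₄ i⟩
  have hN := fun i => isVectorBundle_saturation (h i) (E.isVectorBundle i)
  choose φ hφ using fun i : Fin r => (h i.castSucc).lift (N i.succ) (ι i.succ ≫ E.map i) (by
    intro U hU s
    have h5 := gradedChain_f_germ hS i U hU ((ι i.succ).app U s)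
    exact hT i ⟨_, (h i.succ).germ_mem hU s, h5⟩)
  refine ⟨⟨N, _, hN, φ⟩, ⟨ι, h₁, hφ⟩, rfl, fun i => ?_⟩
  have := (G i).finite (E.isVectorBundle i)
  have h6 := hasDegree_order (h i).genericFibre (hN i) (finBasis C.X.functionField (T i))
  have h7 : (h i).genericFibre.stalk = OrderSystem.sub (S := C.orderSystem) (G i).stalk (T i) :=
    funext (h i).stalk_genericFibre
  rw [h7] at h6
  exact h6

/-- Stable families of subspaces come from subchains of the same ranks and degrees by
`exists_subchain`, so the slope inequalities carry over with denominators cleared. -/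
theorem IsSemistable.gradedChain (hE : E.IsSemistable α) (h0 : E.rank ≠ 0)
    (hd : E.HasDegree d) (hS : C.orderSystem.PrincipalDegreeZero) :
    (E.gradedChain hS).IsSemistable α (chainSlope α E.rank d) where
  le T hT := by
    obtain ⟨F, hFE, hF, he⟩ := exists_subchain hS T hT
    by_cases hF0 : F.rank = 0
    -- Semistability says nothing about the zero subchain, but then every subspace is 0 and has
    -- excess 0.
    · refine (Finset.sum_eq_zero fun i _ => ?_).le
      have : finrank C.X.functionField (T i) = 0 :=
        (congrFun hF i).symm.trans (congrFun hF0 i)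
      rw [Submodule.finrank_eq_zero.1 this, GradedChain.excess_bot]
    · have := (Finset.sum_div_sum_le_iff (sum_natCast_pos hF0)).1 (hE F d _ hd he hFE hF0)
      rw [hF] at this
      exact this
  top := by
    rw [← sum_add_mul_chainSlope (α := α) (d := d) h0]
    refine Finset.sum_congr rfl fun i _ => ?_
    rw [GradedChain.excess, hE.deg_gradedChain_top h0 hd, finrank_top, finrank_gradedChain]

end SmoothProjectiveCurve.Chain

/-! ### Translation into the stated inequalities. -/

theorem sum_ite_mem_Icc {r : ℕ} (k j : Fin (r + 1)) (hkj : k ≤ j) (a b : ℝ)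
    (α x y : Fin (r + 1) → ℝ) :
    ∑ i, ((if i ∈ Finset.Icc k j then a else x i) +
        α i * (if i ∈ Finset.Icc k j then b else y i)) =
      ∑ i ∈ (Finset.Icc k j)ᶜ, (x i + α i * y i) + ((j : ℝ) - (k : ℝ) + 1) * a +
        (∑ i ∈ Finset.Icc k j, α i) * b := by
  have h1 : ∑ i ∈ Finset.Icc k j, ((if i ∈ Finset.Icc k j then a else x i) +
      α i * (if i ∈ Finset.Icc k j then b else y i)) = ∑ i ∈ Finset.Icc k j, (a + α i * b) :=
    Finset.sum_congr rfl fun i hi => by rw [if_pos hi, if_pos hi]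
  have h2 : ∑ i ∈ (Finset.Icc k j)ᶜ, ((if i ∈ Finset.Icc k j then a else x i) +
      α i * (if i ∈ Finset.Icc k j then b else y i)) = ∑ i ∈ (Finset.Icc k j)ᶜ, (x i + α i * y i) :=
    Finset.sum_congr rfl fun i hi => by
      rw [if_neg (Finset.mem_compl.1 hi), if_neg (Finset.mem_compl.1 hi)]
  have h3 : (k : ℕ) ≤ j + 1 := Nat.le_succ_of_le hkj
  rw [← Finset.sum_add_sum_compl (Finset.Icc k j), h1, h2, Finset.sum_add_distrib, Finset.sum_const,
    Fin.card_Icc, ← Finset.sum_mul, nsmul_eq_mul, Nat.cast_sub h3]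
  push_cast
  ring

theorem sum_ite_mem_Icc_eq_sub {r : ℕ} (k j : Fin (r + 1)) (a b : ℝ)
    (α x y : Fin (r + 1) → ℝ) :
    ∑ i, ((if i ∈ Finset.Icc k j then a else x i) +
        α i * (if i ∈ Finset.Icc k j then b else y i)) =
      ∑ i, (x i + α i * y i) - ∑ i ∈ Finset.Icc k j, (x i - a + α i * (y i - b)) := by
  rw [eq_sub_iff_add_eq', ← Finset.sum_add_sum_compl (Finset.Icc k j),
    ← Finset.sum_add_sum_compl (Finset.Icc k j) fun i => x i + α i * y i, ← add_assoc,
    ← Finset.sum_add_distrib]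
  congr 1
  · refine Finset.sum_congr rfl fun i hi => ?_
    rw [if_pos hi, if_pos hi]
    ring
  · refine Finset.sum_congr rfl fun i hi => ?_
    rw [if_neg (Finset.mem_compl.1 hi), if_neg (Finset.mem_compl.1 hi)]

theorem mainTheorem5 {K : Type u} [Field K] (C : SmoothProjectiveCurve K) (r : ℕ)
    (n : Fin (r + 1) → ℕ) (d : Fin (r + 1) → ℤ) (α : Fin (r + 1) → ℝ) (hα : StrictMono α)
    (E : C.Chain r) (hn : E.rank = n) (hd : E.HasDegree d) (hE : E.IsSemistable α) :
    -- (1)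
    (∀ j : Fin (r + 1), j < Fin.last r → 0 < ∑ i ∈ Finset.Iic j, (n i : ℝ) →
      (∑ i ∈ Finset.Iic j, ((d i : ℝ) + α i * (n i : ℝ))) / (∑ i ∈ Finset.Iic j, (n i : ℝ))
        ≤ chainSlope α n d) ∧
    -- (2)
    (∀ j : Fin r, n j.succ = n j.castSucc → 0 < n j.succ →
      (d j.succ : ℝ) / (n j.succ : ℝ) ≤ (d j.castSucc : ℝ) / (n j.castSucc : ℝ)) ∧
    -- (3)
    (∀ k j : Fin (r + 1), k < j → (∀ i ∈ Finset.Ico k j, n j < n i) →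
      0 < ∑ i ∈ (Finset.Icc k j)ᶜ, (n i : ℝ) + ((j : ℝ) - (k : ℝ) + 1) * (n j : ℝ) →
      (∑ i ∈ (Finset.Icc k j)ᶜ, ((d i : ℝ) + α i * (n i : ℝ))
            + ((j : ℝ) - (k : ℝ) + 1) * (d j : ℝ) + (∑ i ∈ Finset.Icc k j, α i) * (n j : ℝ))
          / (∑ i ∈ (Finset.Icc k j)ᶜ, (n i : ℝ) + ((j : ℝ) - (k : ℝ) + 1) * (n j : ℝ))
        ≤ chainSlope α n d ∧
      chainSlope α (fun i => if i ∈ Finset.Icc k j then n j else n i)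
          (fun i => if i ∈ Finset.Icc k j then d j else d i)
        ≤ chainSlope α n d) ∧
    -- (4)
    (∀ k j : Fin (r + 1), k < j →
      ((∀ i ∈ Finset.Ico k j, n i < n j) ∨ (∀ i ∈ Finset.Ioc k j, n k < n i)) →
      (0 < ∑ i ∈ Finset.Ioc k j, ((n i : ℝ) - (n k : ℝ)) →
        (∑ i ∈ Finset.Ioc k j,
              ((d i : ℝ) - (d k : ℝ) + α i * ((n i : ℝ) - (n k : ℝ))))
            / (∑ i ∈ Finset.Ioc k j, ((n i : ℝ) - (n k : ℝ)))
          ≤ chainSlope α n d) ∧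
      (0 < ∑ i, ((if i ∈ Finset.Icc k j then n k else n i : ℕ) : ℝ) →
        chainSlope α n d ≤
          chainSlope α (fun i => if i ∈ Finset.Icc k j then n k else n i)
            (fun i => if i ∈ Finset.Icc k j then d k else d i))) := by
  subst hn
  by_cases h0 : E.rank = 0
  -- For the zero chain every denominator is 0, so each positivity condition fails.
  · simp [h0]
  have hS := hE.principalDegreeZero h0 hd
  have hG := hE.gradedChain h0 hd hS
  have hA := hG.sum_Iic_le
  have hB := hG.sum_Icc_nonneg hα.monotone
  have hC := hG.sum_Icc_nonpos hα.monotone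
  have hT := sum_add_mul_chainSlope (α := α) (d := d) h0
  simp only [GradedChain.excess, hE.deg_gradedChain_top h0 hd, finrank_top,
    SmoothProjectiveCurve.Chain.finrank_gradedChain] at hA hB hC
  set μ := chainSlope α E.rank d
  -- The total excess of E is 0, so the excess of the modified numerical data is minus the change
  -- made on [k, j].
  have hsub : ∀ (k j l : Fin (r + 1)),
    ∑ i, (((if i ∈ Finset.Icc k j then d l else d i : ℤ) : ℝ) +
        (α i - μ) * ((if i ∈ Finset.Icc k j then E.rank l else E.rank i : ℕ) : ℝ)) =
      - ∑ i ∈ Finset.Icc k j, ((d i : ℝ) - d l + (α i - μ) * ((E.rank i : ℝ) - E.rank l)) := by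
    intro k j l
    rw [← zero_sub, ← hT, ← sum_ite_mem_Icc_eq_sub]
    push_cast
    rfl
  refine ⟨fun j _ hj => (Finset.sum_div_sum_le_iff hj).2 (hA j), fun j hj hj0 => ?_,
    fun k j hkj _ hpos => ?_, fun k j hkj _ => ⟨fun hpos => ?_, fun hpos => ?_⟩⟩
  -- On a two-element interval with equal ranks the terms in α − μ vanish, leaving the comparison of
  -- degrees.
  · have h := hB j.castSucc j.succ
    have hIcc : Finset.Icc j.castSucc j.succ = {j.castSucc, j.succ} := by
      ext i
      simp only [Finset.mem_Icc, Finset.mem_insert, Finset.mem_singleton, Fin.le_def, Fin.ext_iff,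
        Fin.val_castSucc, Fin.val_succ]
      omega
    rw [hIcc, Finset.sum_pair (Fin.castSucc_lt_succ).ne, hj] at h
    rw [hj]
    refine div_le_div_of_nonneg_right ?_ (Nat.cast_nonneg _)
    linarith
  · have hden : ∑ i, ((if i ∈ Finset.Icc k j then E.rank j else E.rank i : ℕ) : ℝ) =
        ∑ i ∈ (Finset.Icc k j)ᶜ, (E.rank i : ℝ) + ((j : ℝ) - (k : ℝ) + 1) * (E.rank j : ℝ) := by
      simpa using sum_ite_mem_Icc k j hkj.le (E.rank j) 0 0 (fun i => (E.rank i : ℝ)) 0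
    have hnum := sum_ite_mem_Icc k j hkj.le (d j) (E.rank j) α (fun i => (d i : ℝ))
      fun i => (E.rank i : ℝ)
    have hle : chainSlope α (fun i => if i ∈ Finset.Icc k j then E.rank j else E.rank i)
        (fun i => if i ∈ Finset.Icc k j then d j else d i) ≤ μ := by
      refine (Finset.sum_div_sum_le_iff (hden ▸ hpos)).2 ?_
      rw [hsub]
      linarith [hB k j]
    refine ⟨?_, hle⟩
    rw [← hnum, ← hden]
    convert hle using 1
    rw [chainSlope]
    push_cast
    rfl
  · refine (Finset.sum_div_sum_le_iff hpos).2 ?_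
    have h := hC k j
    -- The term i = k is 0, so the sum over [k, j] is the sum over (k, j].
    rw [← Finset.Ioc_insert_left hkj.le, Finset.sum_insert (by simp)] at h
    simpa using h
  · refine (Finset.le_sum_div_sum_iff hpos).2 ?_
    rw [hsub]
    have h := hC k j
    linarith
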